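/- **Setting.** Let $s^*\in(0,1)$ and let $f:[0,1]\to\mathbb R$ be piecewise $C^3$ with a single jump at $s^*$: $f=f^-$ on $[0,s^*)$ and $f=f^+$ on $(s^*,1]$, where $f^-\in C^3([0,s^*])$, $f^+\in C^3([s^*,1])$ and $f^-(s^*)\neq f^+(s^*)$ (the value $f(s^*)$ is arbitrary). Let $F(x)=\int_0^x f(y)\,dy$. For $N\in\mathbb N$ put $h=1/N$, $x_j=jh$ $(j\in\mathbb Z)$, let $\bar f_j=\frac1h\int_{x_{j-1}}^{x_j}f(x)\,dx$ $(1\le j\le N)$ be the given cell averages, and put $F_j=h\sum_{i=1}^j\bar f_i$ for $0\le j\le N$ and $F_j=0$ for $j<0$ and $j>N$. **The regularization-correction (RC) algorithm.** For $m\in\mathbb Z$ let $P_m$ be the polynomial of degree at most $3$ with $P_m(x_i)=F_i$ for $i=m,\dots,m+3$. * *Detection.* Let $k$ be an index, $1\le k\le N-1$, for which $|F_{k-1}-2F_k+F_{k+1}|$ is maximal. The detected interval $[x_a,x_b]$ is $[x_{k-1},x_{k+1}]$; if $k$ and $k+1$ are both maximizers, $[x_k,x_{k+1}]$ may be taken instead.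 * *Location.* $x^*$ is a point of $[x_a,x_b]$ at which the cubics $p^-=P_{a-3}$ and $p^+=P_b$, which interpolate the data at the four grid points to the left and to the right of $[x_a,x_b]$, coincide. * *Smoothing.* Let $T(x)=\mathbf 1_{x\ge0}P_0(x)+\mathbf 1_{x\ge x^*}\bigl(p^+(x)-p^-(x)\bigr)-\mathbf 1_{x>1}P_{N-3}(x)$ (the boundary points are treated as singularities of known position) and $d_i=F_i-T(x_i)$, $i\in\mathbb Z$. * *Subdivision.* Let $S$ be the 4-point Dubuc–Deslauriers scheme, $(Sd)_{2j}=d_j$, $(Sd)_{2j+1}=-\frac1{16}d_{j-1}+\frac9{16}d_j+\frac9{16}d_{j+1}-\frac1{16}d_{j+2}$, and let $u$ be its limit function for the data $d$, that is, the continuous function with $u(2^{-k}x_j)=(S^kd)_j$ for all $k\ge0$, $j\in\mathbb Z$. * *Correction.* $G(x)=u(x)+P_0(x)+\mathbf 1_{x\ge x^*}\bigl(p^+(x)-p^-(x)\bigr)$; on $[0,1]$ this is $u+T$. Put $g=G'$. **Theorem.** There are $C$ and $N_0\ge 1$, depending only on $f$, such that for all $N\ge N_0$ the following holds. The detection step returns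 at least one interval $[x_a,x_b]$; every interval it may return contains $s^*$, and in it there is exactly one intersection point $x^*$ of $p^-$ and $p^+$. Moreover, for every interval $[x_a,x_b]$ consisting of one or two cells with $s^*\in[x_a,x_b]$ (in particular the detected one), and every point $x^*\in[x_a,x_b]$ with $p^-(x^*)=p^+(x^*)$: 1. $|s^*-x^*|\le Ch^4$. 2. The approximation $G$ exists and is unique, it satisfies $G(x_j)=F_j$ for $0\le j\le N$, and $|F(x)-G(x)|\le Ch^4$ for all $x\in[0,1]$. 3. $G$ is differentiable at every $x\ne x^*$, and $|f(x)-g(x)|\le Ch^3$ for every $x\in[0,1]$ that is not in the closed interval between $s^*$ and $x^*$. 4. With $\delta=x^*-s^*$, $|f(x)-g(x+\delta)|\le Ch^3$ for all $x\in[0,1]\setminus\{s^*\}$. -/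

import Mathlib

open Polynomial

noncomputable section

namespace RC

/-- `f` is piecewise `C³` on `[0,1]`, its only singular point is `s ∈ (0,1)`, and there it has a
jump discontinuity: on either side of `s` it agrees with a function that is `C³` up to the
endpoints, and the two one-sided values at `s` differ. The value `f s` itself is arbitrary. -/
def IsPiecewiseC3WithJump (f : ℝ → ℝ) (s : ℝ) : Prop :=
  s ∈ Set.Ioo (0 : ℝ) 1 ∧
    ∃ fm fp : ℝ → ℝ,
      ContDiffOn ℝ 3 fm (Set.Icc 0 s) ∧ ContDiffOn ℝ 3 fp (Set.Icc s 1) ∧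
      Set.EqOn f fm (Set.Ico 0 s) ∧ Set.EqOn f fp (Set.Ioc s 1) ∧
      fm s ≠ fp s

/-- The grid point `x_j = j h`, where `h = 1 / N`. -/
def node (N : ℕ) (j : ℤ) : ℝ := (j : ℝ) / N

/-- The cell average of `f` over the cell `[x_{j-1}, x_j]`. -/
def cellAverage (f : ℝ → ℝ) (N : ℕ) (j : ℤ) : ℝ :=
  (1 / (1 / (N : ℝ))) * ∫ x in node N (j - 1)..node N j, f x

/-- The values `F_j = h ∑_{i=1}^{j} f̄_i`, `0 ≤ j ≤ N`, obtained from the cell averages, padded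
by zero outside the grid of `[0,1]`. -/
def primitiveData (N : ℕ) (avg : ℤ → ℝ) (j : ℤ) : ℝ :=
  if 0 ≤ j ∧ j ≤ N then (1 / (N : ℝ)) * ∑ i ∈ Finset.Icc 1 j, avg i else 0

/-- The second difference of the data at the grid point `x_k`. -/
def secondDiff (F : ℤ → ℝ) (k : ℤ) : ℝ := F (k - 1) - 2 * F k + F (k + 1)

/-- Among the second differences at interior grid points, the one at `x_k` is of largest
modulus. -/
def IsMaxSecondDiff (N : ℕ) (F : ℤ → ℝ) (k : ℤ) : Prop :=
  (1 ≤ k ∧ k + 1 ≤ N) ∧ ∀ i : ℤ, 1 ≤ i → i + 1 ≤ N → |secondDiff F i| ≤ |secondDiff F k|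

/-- Detection of the singularity by comparison of second differences. If `x_k` carries the
largest one, the two cells adjacent to `x_k` are suspicious; if two neighbouring grid points share
the maximum, the cell between them may be returned instead. The result is `[x_a, x_b]`. -/
def IsDetected (N : ℕ) (F : ℤ → ℝ) (a b : ℤ) : Prop :=
  (b = a + 2 ∧ IsMaxSecondDiff N F (a + 1)) ∨
    (b = a + 1 ∧ IsMaxSecondDiff N F a ∧ IsMaxSecondDiff N F (a + 1))

/-- The polynomial of degree at most three that interpolates the data at the four grid points
`x_m, x_{m+1}, x_{m+2}, x_{m+3}`. -/
def cubic (N : ℕ) (F : ℤ → ℝ) (m : ℤ) : ℝ[X] :=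
  Lagrange.interpolate (Finset.Icc m (m + 3)) (node N) F

/-- The cubic interpolating at the four grid points to the left of the interval `[x_a, x_b]`. -/
def leftCubic (N : ℕ) (F : ℤ → ℝ) (a : ℤ) : ℝ[X] := cubic N F (a - 3)

/-- The cubic interpolating at the four grid points to the right of the interval `[x_a, x_b]`. -/
def rightCubic (N : ℕ) (F : ℤ → ℝ) (b : ℤ) : ℝ[X] := cubic N F b

/-- `xs` is an intersection point, in `[x_a, x_b]`, of the left and the right cubic. -/
def IsLocated (N : ℕ) (F : ℤ → ℝ) (a b : ℤ) (xs : ℝ) : Prop :=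
  xs ∈ Set.Icc (node N a) (node N b) ∧
    (leftCubic N F a).eval xs = (rightCubic N F b).eval xs

/-- The one-sided cubic correction at `xs`. Solving the two `4 × 4` systems for the one-sided
derivatives at `xs` yields the Taylor coefficients at `xs` of the two interpolating cubics, so the
cubic built from the approximate jumps is the difference of these two. -/
def jumpCorrection (N : ℕ) (F : ℤ → ℝ) (a b : ℤ) (xs x : ℝ) : ℝ :=
  if xs ≤ x then (rightCubic N F b).eval x - (leftCubic N F a).eval x else 0

/-- The total correction for the zero-padded data: the boundary points `0` and `1` count as
singular points of known position, with vanishing data outside `[0,1]`. -/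
def totalCorrection (N : ℕ) (F : ℤ → ℝ) (a b : ℤ) (xs x : ℝ) : ℝ :=
  (if 0 ≤ x then (cubic N F 0).eval x else 0) + jumpCorrection N F a b xs x -
    (if 1 < x then (cubic N F (N - 3)).eval x else 0)

/-- The smoothed data. -/
def smoothedData (N : ℕ) (F : ℤ → ℝ) (a b : ℤ) (xs : ℝ) (i : ℤ) : ℝ :=
  F i - totalCorrection N F a b xs (node N i)

/-- One step of the four-point Dubuc–Deslauriers subdivision scheme. -/
def subdivide (d : ℤ → ℝ) (i : ℤ) : ℝ :=
  if Even i then d (i / 2)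
  else -(1 / 16) * d (i / 2 - 1) + 9 / 16 * d (i / 2) + 9 / 16 * d (i / 2 + 1)
    - 1 / 16 * d (i / 2 + 2)

/-- `u` is the limit function of the (interpolatory) subdivision scheme started from the data `d`
on the grid `x_j = j / N`: it is continuous and takes the value `(S^k d)_j` at `j 2^{-k} / N`. -/
def IsSubdivisionLimit (N : ℕ) (d : ℤ → ℝ) (u : ℝ → ℝ) : Prop :=
  Continuous u ∧ ∀ (k : ℕ) (j : ℤ), u (node N j / 2 ^ k) = (subdivide^[k] d) j

/-- `G` is the regularization-correction approximation for the data `F`, with singularity interval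
`[x_a, x_b]` and singular point `xs`: the limit function for the smoothed data plus the correction.
On `[0,1]` the term added is `totalCorrection`; beyond the boundary points (needed only for
translates of `G'`) the same one-sided expressions are continued. -/
def IsRCApproximation (N : ℕ) (F : ℤ → ℝ) (a b : ℤ) (xs : ℝ) (G : ℝ → ℝ) : Prop :=
  ∃ u : ℝ → ℝ, IsSubdivisionLimit N (smoothedData N F a b xs) u ∧
    ∀ x, G x = u x + ((cubic N F 0).eval x + jumpCorrection N F a b xs x)

theorem totalCorrection_of_mem_Icc (N : ℕ) (F : ℤ → ℝ) (a b : ℤ) (xs : ℝ) {x : ℝ}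
    (hx : x ∈ Set.Icc (0 : ℝ) 1) :
    totalCorrection N F a b xs x = (cubic N F 0).eval x + jumpCorrection N F a b xs x := by
  simp [totalCorrection, hx.1, not_lt.mpr hx.2]

end RC

end

namespace RC

open Filter Topology

theorem subdivide_two_mul (d : ℤ → ℝ) (j : ℤ) : subdivide d (2 * j) = d j := by
  simp [subdivide]

theorem subdivide_two_mul_add_one (d : ℤ → ℝ) (j : ℤ) :
    subdivide d (2 * j + 1) = -(1 / 16) * d (j - 1) + 9 / 16 * d j + 9 / 16 * d (j + 1)
      - 1 / 16 * d (j + 2) := by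
  have h : (2 * j + 1) / 2 = j := by omega
  have h' : ¬ Even (2 * j + 1) := by
    rw [Int.not_even_iff_odd]
    exact odd_two_mul_add_one j
  simp [subdivide, h, h']

theorem subdivide_add (d e : ℤ → ℝ) : subdivide (d + e) = subdivide d + subdivide e := by
  funext i
  simp only [subdivide, Pi.add_apply]
  split_ifs
  · rfl
  · ring

theorem iterate_subdivide_add (d e : ℤ → ℝ) (k : ℕ) :
    subdivide^[k] (d + e) = subdivide^[k] d + subdivide^[k] e := by
  induction k generalizing d e with
  | zero => rfl
  | succ k ih => simp only [Function.iterate_succ_apply, subdivide_add, ih]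

/-- The scheme reproduces cubic polynomials. -/
theorem iterate_subdivide_cubic (c₀ c₁ c₂ c₃ : ℝ) (k : ℕ) (j : ℤ) :
    subdivide^[k] (fun i : ℤ => c₀ + c₁ * i + c₂ * (i : ℝ) ^ 2 + c₃ * (i : ℝ) ^ 3) j =
      c₀ + c₁ * (j / 2 ^ k : ℝ) + c₂ * (j / 2 ^ k : ℝ) ^ 2 + c₃ * (j / 2 ^ k : ℝ) ^ 3 := by
  induction k generalizing c₀ c₁ c₂ c₃ with
  | zero => simp
  | succ k ih =>
    have h : subdivide (fun i : ℤ => c₀ + c₁ * i + c₂ * (i : ℝ) ^ 2 + c₃ * (i : ℝ) ^ 3) =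
        fun i : ℤ => c₀ + c₁ / 2 * i + c₂ / 4 * (i : ℝ) ^ 2 + c₃ / 8 * (i : ℝ) ^ 3 := by
      funext i
      rcases Int.even_or_odd' i with ⟨m, rfl | rfl⟩
      · rw [subdivide_two_mul]
        push_cast
        ring
      · rw [subdivide_two_mul_add_one]
        push_cast
        ring
    rw [Function.iterate_succ_apply, h, ih]
    field_simp
    ring

/-- The scheme is local: `(S^k d)_i` depends only on the data within distance three of
`i / 2^k`. -/
theorem iterate_subdivide_congr {d e : ℤ → ℝ} {k : ℕ} {i : ℤ}
    (h : ∀ j : ℤ, |(j : ℝ) - i / 2 ^ k| ≤ 3 → d j = e j) :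
    subdivide^[k] d i = subdivide^[k] e i := by
  induction k generalizing d e with
  | zero => exact h i (by simp)
  | succ k ih =>
    rw [Function.iterate_succ_apply, Function.iterate_succ_apply]
    refine ih fun j hj => ?_
    have e2 : (i : ℝ) / 2 ^ (k + 1) = (i / 2 ^ k) / 2 := by
      rw [pow_succ, div_div]
    rw [e2] at h
    generalize (i : ℝ) / 2 ^ k = t at h hj
    rw [abs_le] at hj
    rcases Int.even_or_odd' j with ⟨m, rfl | rfl⟩
    · rw [subdivide_two_mul, subdivide_two_mul]
      push_cast at hj
      exact h m (abs_le.mpr ⟨by linarith, by linarith⟩)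
    · push_cast at hj
      rw [subdivide_two_mul_add_one, subdivide_two_mul_add_one,
        h (m - 1) (by push_cast; exact abs_le.mpr ⟨by linarith, by linarith⟩),
        h m (abs_le.mpr ⟨by linarith, by linarith⟩),
        h (m + 1) (by push_cast; exact abs_le.mpr ⟨by linarith, by linarith⟩),
        h (m + 2) (by push_cast; exact abs_le.mpr ⟨by linarith, by linarith⟩)]

theorem iterate_subdivide_two_pow_mul (d : ℤ → ℝ) (n m : ℕ) (j : ℤ) :
    subdivide^[m + n] d (2 ^ n * j) = subdivide^[m] d j := by
  induction n with
  | zero => simp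
  | succ n ih =>
    rw [← add_assoc, Function.iterate_succ_apply', pow_succ', mul_assoc, subdivide_two_mul, ih]

theorem floor_two_pow_succ_mul_div_two (x : ℝ) (k : ℕ) :
    ⌊2 ^ (k + 1) * x⌋ / 2 = ⌊2 ^ k * x⌋ := by
  have h := Int.floor_div_natCast (2 ^ (k + 1) * x) 2
  rw [Nat.cast_ofNat] at h
  rw [show (2 : ℤ) = ((2 : ℕ) : ℤ) from rfl, ← h, pow_succ]
  congr 1
  ring

/-- A family of sequences on dyadic grids whose refinements change geometrically little has a
continuous limit. -/
theorem exists_continuous_limit {V : ℕ → ℤ → ℝ} {A r : ℝ} (hr₀ : 0 ≤ r) (hr : r < 1)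
    (hV : ∀ k i, |V k (i / 2) - V (k + 1) i| ≤ A * r ^ k)
    (hW : ∀ k i, |V k (i + 1) - V k i| ≤ A * r ^ k) :
    ∃ ψ : ℝ → ℝ, Continuous ψ ∧ ∀ k x, |V k ⌊2 ^ k * x⌋ - ψ x| ≤ A * r ^ k / (1 - r) := by
  have hd : ∀ x : ℝ, ∀ k, dist (V k ⌊2 ^ k * x⌋) (V (k + 1) ⌊2 ^ (k + 1) * x⌋) ≤ A * r ^ k := by
    intro x k
    rw [← floor_two_pow_succ_mul_div_two, Real.dist_eq]
    exact hV k _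
  have hlim : ∀ x : ℝ, ∃ y, Tendsto (fun k => V k ⌊2 ^ k * x⌋) atTop (𝓝 y) := fun x =>
    cauchySeq_tendsto_of_complete (cauchySeq_of_le_geometric r A hr (hd x))
  choose ψ hψ using hlim
  have hb : ∀ k x, |V k ⌊2 ^ k * x⌋ - ψ x| ≤ A * r ^ k / (1 - r) := fun k x => by
    rw [← Real.dist_eq]
    exact dist_le_of_le_geometric_of_tendsto r A hr (hd x) (hψ x) k
  refine ⟨ψ, ?_, hb⟩
  rw [Metric.continuous_iff]
  intro x ε hε
  have ht : Tendsto (fun k : ℕ => A * r ^ k / (1 - r) + A * r ^ k / (1 - r) + A * r ^ k)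
      atTop (𝓝 (A * 0 / (1 - r) + A * 0 / (1 - r) + A * 0)) := by
    have h0 := tendsto_pow_atTop_nhds_zero_of_lt_one hr₀ hr
    exact (((h0.const_mul A).div_const _).add ((h0.const_mul A).div_const _)).add (h0.const_mul A)
  have hev := ht.eventually_lt_const (u := ε) (by simpa using hε)
  obtain ⟨k, hk⟩ := hev.exists
  refine ⟨1 / 2 ^ k, by positivity, fun y hy => ?_⟩
  have hAr : 0 ≤ A * r ^ k := (abs_nonneg _).trans (hW k 0)
  have hfl : |V k ⌊2 ^ k * y⌋ - V k ⌊2 ^ k * x⌋| ≤ A * r ^ k := by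
    have hxy : |2 ^ k * y - 2 ^ k * x| < 1 := by
      rw [← mul_sub, abs_mul, abs_of_pos (by positivity : (0 : ℝ) < 2 ^ k), ← Real.dist_eq]
      calc _ < (2 : ℝ) ^ k * (1 / 2 ^ k) := by gcongr
        _ = 1 := by field_simp
    rw [abs_lt] at hxy
    have h1 := Int.floor_le (2 ^ k * y)
    have h2 := Int.lt_floor_add_one (2 ^ k * y)
    have h3 := Int.floor_le (2 ^ k * x)
    have h4 := Int.lt_floor_add_one (2 ^ k * x)
    have h5 : ⌊2 ^ k * y⌋ < ⌊2 ^ k * x⌋ + 2 := by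
      have : (⌊2 ^ k * y⌋ : ℝ) < ⌊2 ^ k * x⌋ + 2 := by linarith
      exact_mod_cast this
    have h6 : ⌊2 ^ k * x⌋ < ⌊2 ^ k * y⌋ + 2 := by
      have : (⌊2 ^ k * x⌋ : ℝ) < ⌊2 ^ k * y⌋ + 2 := by linarith
      exact_mod_cast this
    generalize ⌊2 ^ k * y⌋ = p at *
    generalize ⌊2 ^ k * x⌋ = q at *
    rcases (by omega : p = q ∨ p = q + 1 ∨ q = p + 1) with rfl | rfl | rfl
    · simpa using hAr
    · exact hW k q
    · rw [abs_sub_comm]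
      exact hW k p
  have hx := hb k x
  have hy' := hb k y
  rw [Real.dist_eq]
  rw [abs_le] at hx hy' hfl
  rw [abs_lt]
  constructor <;> linarith

/-- The divided differences of the refined data. -/
noncomputable def slope (d : ℤ → ℝ) (k : ℕ) (i : ℤ) : ℝ :=
  2 ^ k * (subdivide^[k] d (i + 1) - subdivide^[k] d i)

theorem slope_succ_two_mul (d : ℤ → ℝ) (k : ℕ) (j : ℤ) :
    slope d (k + 1) (2 * j) =
      slope d k j + (slope d k (j - 1) - slope d k (j + 1)) / 8 := by
  simp only [slope, Function.iterate_succ_apply']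
  rw [subdivide_two_mul, subdivide_two_mul_add_one, sub_add_cancel, show j + 1 + 1 = j + 2 by ring,
    pow_succ]
  ring

theorem slope_succ_two_mul_add_one (d : ℤ → ℝ) (k : ℕ) (j : ℤ) :
    slope d (k + 1) (2 * j + 1) =
      slope d k j - (slope d k (j - 1) - slope d k (j + 1)) / 8 := by
  simp only [slope, Function.iterate_succ_apply']
  rw [show 2 * j + 1 + 1 = 2 * (j + 1) by ring, subdivide_two_mul, subdivide_two_mul_add_one,
    sub_add_cancel, show j + 1 + 1 = j + 2 by ring, pow_succ]
  ring

/-- First and second differences of the slopes decay geometrically. -/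
theorem abs_slope_differences_le {d : ℤ → ℝ} {ε : ℝ} (hd : ∀ i, |d i| ≤ ε) (k : ℕ) :
    (∀ i, |slope d k (i + 1) - slope d k i| ≤ 8 * ε * (3 / 4) ^ k) ∧
      ∀ i, |(slope d k (i + 2) - slope d k (i + 1)) - (slope d k (i + 1) - slope d k i)| ≤
        8 * ε * (3 / 4) ^ k := by
  induction k with
  | zero =>
    simp only [slope, pow_zero, Function.iterate_zero, id, one_mul, mul_one]
    constructor <;> intro i
    · have h0 := abs_le.mp (hd i)
      have h1 := abs_le.mp (hd (i + 1))
      have h2 := abs_le.mp (hd (i + 1 + 1))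
      rw [abs_le]
      constructor <;> linarith
    · rw [show i + 1 + 1 = i + 2 by ring]
      have h0 := abs_le.mp (hd i)
      have h1 := abs_le.mp (hd (i + 1))
      have h2 := abs_le.mp (hd (i + 2))
      have h3 := abs_le.mp (hd (i + 2 + 1))
      rw [abs_le]
      constructor <;> linarith
  | succ k ih =>
    obtain ⟨hW, hZ⟩ := ih
    rw [pow_succ]
    set B := 8 * ε * (3 / 4) ^ k with hB
    rw [show 8 * ε * ((3 / 4) ^ k * (3 / 4)) = B * (3 / 4) by rw [hB]; ring]
    constructor <;> intro i
    · rcases Int.even_or_odd' i with ⟨m, rfl | rfl⟩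
      · rw [slope_succ_two_mul, slope_succ_two_mul_add_one]
        have h1 := abs_le.mp (hW m)
        have h2 := abs_le.mp (hW (m - 1))
        rw [sub_add_cancel] at h2
        rw [abs_le]
        constructor <;> linarith
      · rw [show 2 * m + 1 + 1 = 2 * (m + 1) by ring, slope_succ_two_mul,
          slope_succ_two_mul_add_one, add_sub_cancel_right, show m + 1 + 1 = m + 2 by ring]
        have h1 := abs_le.mp (hW m)
        have h2 := abs_le.mp (hZ m)
        have h3 := abs_le.mp (hZ (m - 1))
        rw [show m - 1 + 2 = m + 1 by ring, sub_add_cancel] at h3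
        rw [abs_le]
        constructor <;> linarith
    · rcases Int.even_or_odd' i with ⟨m, rfl | rfl⟩
      · rw [show 2 * m + 2 = 2 * (m + 1) by ring, slope_succ_two_mul,
          slope_succ_two_mul_add_one, slope_succ_two_mul, add_sub_cancel_right,
          show m + 1 + 1 = m + 2 by ring]
        have h2 := abs_le.mp (hZ m)
        have h3 := abs_le.mp (hZ (m - 1))
        rw [show m - 1 + 2 = m + 1 by ring, sub_add_cancel] at h3
        rw [abs_le]
        constructor <;> linarith
      · rw [show 2 * m + 1 + 2 = 2 * (m + 1) + 1 by ring, slope_succ_two_mul_add_one,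
          show 2 * m + 1 + 1 = 2 * (m + 1) by ring, slope_succ_two_mul,
          slope_succ_two_mul_add_one, add_sub_cancel_right, show m + 1 + 1 = m + 2 by ring]
        have h2 := abs_le.mp (hZ m)
        have h3 := abs_le.mp (hZ (m - 1))
        rw [show m - 1 + 2 = m + 1 by ring, sub_add_cancel] at h3
        rw [abs_le]
        constructor <;> linarith

theorem abs_slope_sub_slope_succ_le {d : ℤ → ℝ} {ε : ℝ} (hd : ∀ i, |d i| ≤ ε) (k : ℕ) (i : ℤ) :
    |slope d k (i / 2) - slope d (k + 1) i| ≤ 2 * ε * (3 / 4) ^ k := by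
  have hW := (abs_slope_differences_le hd k).1
  rcases Int.even_or_odd' i with ⟨m, rfl | rfl⟩
  · rw [slope_succ_two_mul, show 2 * m / 2 = m by omega]
    have h1 := abs_le.mp (hW m)
    have h2 := abs_le.mp (hW (m - 1))
    rw [sub_add_cancel] at h2
    rw [abs_le]
    constructor <;> linarith
  · rw [slope_succ_two_mul_add_one, show (2 * m + 1) / 2 = m by omega]
    have h1 := abs_le.mp (hW m)
    have h2 := abs_le.mp (hW (m - 1))
    rw [sub_add_cancel] at h2
    rw [abs_le]
    constructor <;> linarith

/-- Bounded data have a continuously differentiable limit function, which is bounded in the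
`C¹`-norm by the data. -/
theorem exists_limit_of_bounded {d : ℤ → ℝ} {ε : ℝ} (hd : ∀ i, |d i| ≤ ε) :
    ∃ u ψ : ℝ → ℝ, (∀ x, HasDerivAt u (ψ x) x) ∧
      (∀ (k : ℕ) (j : ℤ), u (j / 2 ^ k) = subdivide^[k] d j) ∧
      (∀ x, |u x| ≤ 35 * ε) ∧ ∀ x, |ψ x| ≤ 34 * ε := by
  have hε : 0 ≤ ε := (abs_nonneg _).trans (hd 0)
  obtain ⟨ψ, hψc, hψ⟩ := exists_continuous_limit (V := slope d) (A := 8 * ε) (r := 3 / 4)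
    (by norm_num) (by norm_num)
    (fun k i => (abs_slope_sub_slope_succ_le hd k i).trans (by gcongr; norm_num))
    (fun k i => (abs_slope_differences_le hd k).1 i)
  have hψ' : ∀ k x, |slope d k ⌊2 ^ k * x⌋ - ψ x| ≤ 32 * ε * (3 / 4) ^ k := fun k x =>
    (hψ k x).trans (le_of_eq (by ring))
  set u : ℝ → ℝ := fun x => d 0 + ∫ y in (0 : ℝ)..x, ψ y with hu
  have hder : ∀ x, HasDerivAt u (ψ x) x := fun x =>
    (intervalIntegral.integral_hasDerivAt_right (hψc.intervalIntegrable _ _)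
      (hψc.stronglyMeasurableAtFilter _ _) hψc.continuousAt).const_add _
  have hcell : ∀ (m : ℕ) (i : ℤ), |(u ((i + 1) / 2 ^ m) - subdivide^[m] d (i + 1)) -
      (u (i / 2 ^ m) - subdivide^[m] d i)| ≤ 1 / 2 ^ m * (32 * ε * (3 / 4) ^ m) := by
    intro m i
    have hpos : (0 : ℝ) < 2 ^ m := by positivity
    have hle : (i : ℝ) / 2 ^ m ≤ (i + 1) / 2 ^ m := by gcongr; linarith
    have hd' : ∀ x, HasDerivAt (fun x => u x - slope d m i * x) (ψ x - slope d m i) x := by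
      intro x
      have h := (hder x).sub ((hasDerivAt_id x).const_mul (slope d m i))
      rw [mul_one] at h
      exact h
    have key := norm_image_sub_le_of_norm_deriv_right_le_segment
      (f := fun x => u x - slope d m i * x) (f' := fun x => ψ x - slope d m i)
      (a := i / 2 ^ m) (b := (i + 1) / 2 ^ m) (C := 32 * ε * (3 / 4) ^ m)
      (fun x _ => (hd' x).continuousAt.continuousWithinAt)
      (fun x _ => (hd' x).hasDerivWithinAt) (fun x hx => by
        have hfl : ⌊2 ^ m * x⌋ = i := by
          rw [Int.floor_eq_iff]
          have h1 := (div_le_iff₀ hpos).mp hx.1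
          have h2 := (lt_div_iff₀ hpos).mp hx.2
          constructor <;> linarith
        have := hψ' m x
        rw [hfl, abs_sub_comm] at this
        exact this) ((i + 1) / 2 ^ m) ⟨hle, le_rfl⟩
    rw [Real.norm_eq_abs] at key
    have e1 : u ((i + 1) / 2 ^ m) - slope d m i * ((i + 1) / 2 ^ m) -
        (u (i / 2 ^ m) - slope d m i * (i / 2 ^ m)) =
        (u ((i + 1) / 2 ^ m) - subdivide^[m] d (i + 1)) -
      (u (i / 2 ^ m) - subdivide^[m] d i) := by
      simp only [slope]
      field_simp
      ring
    have e2 : ((i : ℝ) + 1) / 2 ^ m - i / 2 ^ m = 1 / 2 ^ m := by ring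
    simp only [e1, e2] at key
    linarith
  have hE : ∀ (m : ℕ) (j : ℤ), |u (j / 2 ^ m) - subdivide^[m] d j| ≤
      |(j : ℝ)| * (1 / 2 ^ m * (32 * ε * (3 / 4) ^ m)) := by
    intro m j
    induction j using Int.induction_on with
    | zero =>
      have := iterate_subdivide_two_pow_mul d m 0 0
      simp only [zero_add, mul_zero, Function.iterate_zero, id] at this
      simp [hu, this]
    | succ n ih =>
      have h := hcell m n
      push_cast at h ih ⊢
      rw [abs_of_nonneg (by positivity : (0 : ℝ) ≤ n)] at ih
      rw [abs_of_nonneg (by positivity : (0 : ℝ) ≤ n + 1)]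
      rw [abs_le] at h ih ⊢
      constructor <;> linarith
    | pred n ih =>
      have h := hcell m (-n - 1)
      push_cast at h ih ⊢
      rw [sub_add_cancel, sub_add_cancel] at h
      rw [abs_neg, abs_of_nonneg (by positivity : (0 : ℝ) ≤ n)] at ih
      rw [← abs_neg (-(n : ℝ) - 1), show -(-(n : ℝ) - 1) = n + 1 by ring,
        abs_of_nonneg (by positivity : (0 : ℝ) ≤ n + 1)]
      rw [abs_le] at h ih ⊢
      constructor <;> linarith
  have hint : ∀ (m : ℕ) (j : ℤ), u (j / 2 ^ m) = subdivide^[m] d j := by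
    intro m j
    have hn : ∀ n : ℕ, |u (j / 2 ^ m) - subdivide^[m] d j| ≤
        |(j : ℝ)| * 32 * ε * (3 / 4) ^ n := by
      intro n
      have h := hE (m + n) (2 ^ n * j)
      rw [iterate_subdivide_two_pow_mul] at h
      have e1 : (((2 ^ n * j : ℤ)) : ℝ) / 2 ^ (m + n) = j / 2 ^ m := by
        push_cast
        field_simp
        ring
      rw [e1] at h
      refine h.trans ?_
      push_cast
      rw [abs_mul, abs_of_pos (by positivity : (0 : ℝ) < 2 ^ n)]
      have e2 : (2 : ℝ) ^ n * |(j : ℝ)| * (1 / 2 ^ (m + n) * (32 * ε * (3 / 4) ^ (m + n))) =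
          (|(j : ℝ)| * 32 * ε * (3 / 4) ^ n) * ((3 / 4) ^ m * (1 / 2 ^ m)) := by
        rw [pow_add, pow_add]
        field_simp
      rw [e2]
      refine mul_le_of_le_one_right (by positivity) ?_
      refine mul_le_one₀ (pow_le_one₀ (by norm_num) (by norm_num)) (by positivity) ?_
      rw [one_div]
      exact inv_le_one_of_one_le₀ (one_le_pow₀ (by norm_num))
    have ht : Tendsto (fun n : ℕ => |(j : ℝ)| * 32 * ε * (3 / 4) ^ n) atTop
        (𝓝 (|(j : ℝ)| * 32 * ε * 0)) :=
      (tendsto_pow_atTop_nhds_zero_of_lt_one (by norm_num) (by norm_num)).const_mul _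
    have := ge_of_tendsto' ht hn
    rw [mul_zero] at this
    exact sub_eq_zero.mp (abs_eq_zero.mp (le_antisymm this (abs_nonneg _)))
  have hψb : ∀ x, |ψ x| ≤ 34 * ε := by
    intro x
    have h := hψ' 0 x
    simp only [slope, pow_zero, one_mul, mul_one, Function.iterate_zero, id] at h
    have h1 := abs_le.mp (hd ⌊x⌋)
    have h2 := abs_le.mp (hd (⌊x⌋ + 1))
    rw [abs_le] at h ⊢
    constructor <;> linarith
  refine ⟨u, ψ, hder, hint, fun x => ?_, hψb⟩
  have h0 := hint 0 ⌊x⌋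
  simp only [pow_zero, div_one, Function.iterate_zero, id] at h0
  have key := Convex.norm_image_sub_le_of_norm_hasDerivWithin_le (f := u) (f' := ψ)
    (s := Set.univ) (C := 34 * ε) (x := (⌊x⌋ : ℝ)) (y := x)
    (fun x _ => (hder x).hasDerivWithinAt) (fun x _ => hψb x) convex_univ
    (Set.mem_univ _) (Set.mem_univ _)
  rw [h0, Real.norm_eq_abs, Real.norm_eq_abs] at key
  have hfr : |x - ⌊x⌋| ≤ 1 := by
    rw [abs_le]
    have h1 := Int.floor_le x
    have h2 := Int.lt_floor_add_one x
    constructor <;> linarith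
  have hk : |u x - d ⌊x⌋| ≤ 34 * ε := key.trans (mul_le_of_le_one_right (by positivity) hfr)
  have h1 := abs_le.mp (hd ⌊x⌋)
  rw [abs_le] at hk ⊢
  constructor <;> linarith

theorem tendsto_floor_two_pow_mul_div (x : ℝ) :
    Tendsto (fun k : ℕ => (⌊2 ^ k * x⌋ : ℝ) / 2 ^ k) atTop (𝓝 x) := by
  rw [tendsto_iff_norm_sub_tendsto_zero]
  have h0 : Tendsto (fun k : ℕ => (1 / 2 : ℝ) ^ k) atTop (𝓝 0) :=
    tendsto_pow_atTop_nhds_zero_of_lt_one (by norm_num) (by norm_num)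
  refine squeeze_zero (fun k => norm_nonneg _) (fun k => ?_) h0
  have hpos : (0 : ℝ) < 2 ^ k := by positivity
  have e : (⌊2 ^ k * x⌋ : ℝ) / 2 ^ k - x = (⌊2 ^ k * x⌋ - 2 ^ k * x) / 2 ^ k := by
    field_simp
  rw [e, norm_div, Real.norm_eq_abs, Real.norm_eq_abs, abs_of_pos hpos, div_pow, one_pow]
  gcongr
  rw [abs_le]
  have h1 := Int.floor_le (2 ^ k * x)
  have h2 := Int.lt_floor_add_one (2 ^ k * x)
  constructor <;> linarith

theorem eq_of_eq_at_dyadic {u v : ℝ → ℝ} (hu : Continuous u) (hv : Continuous v) {t ρ x : ℝ}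
    (hx : |x - t| < ρ)
    (h : ∀ (k : ℕ) (j : ℤ), |(j : ℝ) / 2 ^ k - t| < ρ → u (j / 2 ^ k) = v (j / 2 ^ k)) :
    u x = v x := by
  have hx' := tendsto_floor_two_pow_mul_div x
  have hev : ∀ᶠ k : ℕ in atTop, |(⌊2 ^ k * x⌋ : ℝ) / 2 ^ k - t| < ρ :=
    ((hx'.sub_const t).abs).eventually_lt_const hx
  refine tendsto_nhds_unique_of_eventuallyEq ((hu.tendsto x).comp hx') ((hv.tendsto x).comp hx') ?_
  filter_upwards [hev] with k hk
  exact h k _ hk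

/-- Limit functions for data that agree near `t` agree near `t`. -/
theorem limit_congr {d e : ℤ → ℝ} {u v : ℝ → ℝ} (hu : Continuous u) (hv : Continuous v)
    (hud : ∀ (k : ℕ) (j : ℤ), u (j / 2 ^ k) = subdivide^[k] d j)
    (hve : ∀ (k : ℕ) (j : ℤ), v (j / 2 ^ k) = subdivide^[k] e j) {t x : ℝ}
    (hde : ∀ j : ℤ, |(j : ℝ) - t| ≤ 4 → d j = e j) (hx : |x - t| < 1) : u x = v x := by
  refine eq_of_eq_at_dyadic hu hv hx fun k j hj => ?_
  rw [hud, hve]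
  refine iterate_subdivide_congr fun i hi => hde i ?_
  rw [abs_le] at hi ⊢
  rw [abs_lt] at hj
  constructor <;> linarith

/-- Any data have a differentiable limit function. -/
theorem exists_limit (d : ℤ → ℝ) :
    ∃ u : ℝ → ℝ, Differentiable ℝ u ∧ ∀ (k : ℕ) (j : ℤ), u (j / 2 ^ k) = subdivide^[k] d j := by
  set cut : ℕ → ℤ → ℝ := fun R j => if |j| ≤ R then d j else 0 with hcut
  have hb : ∀ R, ∀ i, |cut R i| ≤ ∑ j ∈ Finset.Icc (-(R : ℤ)) R, |d j| := by
    intro R i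
    simp only [hcut]
    split_ifs with h
    · exact Finset.single_le_sum (f := fun j => |d j|) (fun _ _ => abs_nonneg _)
        (Finset.mem_Icc.mpr (abs_le.mp h))
    · rw [abs_zero]
      exact Finset.sum_nonneg fun _ _ => abs_nonneg _
  choose U ψ hU hUd _ _ using fun R => exists_limit_of_bounded (hb R)
  have hUc : ∀ R, Continuous (U R) := fun R =>
    continuous_iff_continuousAt.mpr fun x => (hU R x).continuousAt
  have hcutd : ∀ (R : ℕ) (t : ℝ), |t| + 4 ≤ R → ∀ j : ℤ, |(j : ℝ) - t| ≤ 4 → cut R j = d j := by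
    intro R t hR j hj
    have h2 : |(j : ℝ)| ≤ R := by
      have := abs_sub_abs_le_abs_sub (j : ℝ) t
      linarith
    have h3 : |j| ≤ (R : ℤ) := by exact_mod_cast h2
    simp [hcut, h3]
  set u : ℝ → ℝ := fun x => U (⌈|x|⌉₊ + 4) x with hu
  have hloc : ∀ (R : ℕ) (x : ℝ), |x| + 4 ≤ R → u x = U R x := by
    intro R x hxR
    have h4 : |x| + 4 ≤ ((⌈|x|⌉₊ + 4 : ℕ) : ℝ) := by
      push_cast
      have := Nat.le_ceil |x|
      linarith
    refine limit_congr (hUc _) (hUc R) (hUd _) (hUd R) (t := x) (fun j hj => ?_) (by simp)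
    rw [hcutd _ x h4 j hj, hcutd R x hxR j hj]
  refine ⟨u, fun x => ?_, fun k j => ?_⟩
  · set R := ⌈|x|⌉₊ + 5
    have hR : |x| + 5 ≤ (R : ℝ) := by
      push_cast [R]
      have := Nat.le_ceil |x|
      linarith
    have hev : u =ᶠ[𝓝 x] U R := by
      filter_upwards [Metric.ball_mem_nhds x one_pos] with z hz
      rw [Metric.mem_ball, Real.dist_eq] at hz
      refine hloc R z ?_
      have := abs_sub_abs_le_abs_sub z x
      linarith
    exact ((hU R x).congr_of_eventuallyEq hev).differentiableAt
  · set t : ℝ := j / 2 ^ k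
    set R := ⌈|t|⌉₊ + 4
    have hR : |t| + 4 ≤ (R : ℝ) := by
      push_cast [R]
      have := Nat.le_ceil |t|
      linarith
    rw [hloc R t hR, hUd]
    exact iterate_subdivide_congr fun i hi => hcutd R t hR i (hi.trans (by norm_num))

theorem eval_eq_cubic_of_degree_lt {q : ℝ[X]} (hq : q.degree < 4) (x : ℝ) :
    q.eval x = q.coeff 0 + q.coeff 1 * x + q.coeff 2 * x ^ 2 + q.coeff 3 * x ^ 3 := by
  have h : q.natDegree < 4 := by
    by_cases h0 : q = 0
    · simp [h0]
    · exact (natDegree_lt_iff_degree_lt h0).mpr hq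
  rw [eval_eq_sum_range' h]
  simp [Finset.sum_range_succ]

theorem node_div_two_pow (N : ℕ) (j : ℤ) (k : ℕ) :
    node N j / 2 ^ k = (j : ℝ) / 2 ^ k / N := by
  rw [node]
  ring

theorem exists_isSubdivisionLimit {N : ℕ} (hN : 0 < N) (d : ℤ → ℝ) :
    ∃ u, Differentiable ℝ u ∧ IsSubdivisionLimit N d u := by
  obtain ⟨U, hU, hUd⟩ := exists_limit d
  have hN' : (N : ℝ) ≠ 0 := by positivity
  have hd : Differentiable ℝ fun x => U (N * x) := hU.comp (differentiable_id.const_mul _)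
  refine ⟨fun x => U (N * x), hd, hd.continuous, fun k j => ?_⟩
  rw [node_div_two_pow, ← hUd]
  field_simp

theorem IsSubdivisionLimit.comp_div {N : ℕ} {d : ℤ → ℝ} {u : ℝ → ℝ}
    (hu : IsSubdivisionLimit N d u) :
    Continuous (fun t => u (t / N)) ∧
      ∀ (k : ℕ) (j : ℤ), u ((j : ℝ) / 2 ^ k / N) = subdivide^[k] d j := by
  refine ⟨hu.1.comp (by fun_prop), fun k j => ?_⟩
  rw [← node_div_two_pow, hu.2]

theorem IsSubdivisionLimit.unique {N : ℕ} (hN : 0 < N) {d : ℤ → ℝ} {u v : ℝ → ℝ}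
    (hu : IsSubdivisionLimit N d u) (hv : IsSubdivisionLimit N d v) : u = v := by
  funext x
  have hN' : (N : ℝ) ≠ 0 := by positivity
  have h := limit_congr hu.comp_div.1 hv.comp_div.1 hu.comp_div.2 hv.comp_div.2
    (t := x * N) (x := x * N) (fun _ _ => rfl) (by simp)
  simpa [mul_div_cancel_right₀ _ hN'] using h

/-- If the data are within `ε` of a cubic `q` near `x`, then so is, up to a constant factor, the
limit function, and likewise its derivative after scaling with the grid. -/
theorem IsSubdivisionLimit.abs_sub_le {N : ℕ} (hN : 0 < N) {d : ℤ → ℝ} {u : ℝ → ℝ}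
    (hu : IsSubdivisionLimit N d u) {q : ℝ[X]} (hq : q.degree < 4) {x ε : ℝ} (hε : 0 ≤ ε)
    (h : ∀ i : ℤ, |(i : ℝ) - x * N| ≤ 4 → |d i - q.eval (node N i)| ≤ ε) :
    |u x - q.eval x| ≤ 35 * ε ∧ |deriv u x - q.derivative.eval x| ≤ 34 * ε * N := by
  have hN' : (N : ℝ) ≠ 0 := by positivity
  set e : ℤ → ℝ := fun i => if |(i : ℝ) - x * N| ≤ 4 then d i - q.eval (node N i) else 0 with he
  obtain ⟨v, ψ, hv, hve, hvb, hψb⟩ := exists_limit_of_bounded (d := e) (ε := ε) (fun i => by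
    simp only [he]
    split_ifs with hi
    · exact h i hi
    · simpa using hε)
  have hw : ∀ z, HasDerivAt (fun z => v (z * N) + q.eval z) (ψ (z * N) * N + q.derivative.eval z)
      z := fun z => by
    have h1 : HasDerivAt (fun z : ℝ => z * N) N z := by
      simpa using (hasDerivAt_id z).mul_const (N : ℝ)
    exact (HasDerivAt.comp z (hv (z * N)) h1).add (q.hasDerivAt z)
  have hwc : Continuous fun t : ℝ => v t + q.eval (t / N) := by
    have : Continuous v := continuous_iff_continuousAt.mpr fun x => (hv x).continuousAt
    exact this.add (q.continuous.comp (by fun_prop))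
  have hwd : ∀ (k : ℕ) (j : ℤ), v ((j : ℝ) / 2 ^ k) + q.eval ((j : ℝ) / 2 ^ k / N) =
      subdivide^[k] (e + fun i : ℤ => q.eval (node N i)) j := by
    intro k j
    have hqn : (fun i : ℤ => q.eval (node N i)) = fun i : ℤ => q.coeff 0 + q.coeff 1 / N * i +
        q.coeff 2 / N ^ 2 * (i : ℝ) ^ 2 + q.coeff 3 / N ^ 3 * (i : ℝ) ^ 3 := by
      funext i
      rw [eval_eq_cubic_of_degree_lt hq, node]
      ring
    rw [iterate_subdivide_add, Pi.add_apply, hve, hqn, iterate_subdivide_cubic,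
      eval_eq_cubic_of_degree_lt hq]
    ring
  have heq : ∀ t, |t - x * N| < 1 → u (t / N) = v t + q.eval (t / N) := fun t ht =>
    limit_congr hu.comp_div.1 hwc hu.comp_div.2 hwd (t := x * N)
      (fun j hj => by simp [he, hj]) ht
  have hx : u x = v (x * N) + q.eval x := by
    have := heq (x * N) (by simp)
    rwa [mul_div_cancel_right₀ _ hN'] at this
  have hev : u =ᶠ[𝓝 x] fun z => v (z * N) + q.eval z := by
    have hc : Tendsto (fun z : ℝ => |z * N - x * N|) (𝓝 x) (𝓝 0) := by
      have : Continuous fun z : ℝ => |z * N - x * N| := by fun_prop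
      simpa using this.tendsto x
    filter_upwards [hc.eventually_lt_const one_pos] with z hz
    have := heq (z * N) hz
    rwa [mul_div_cancel_right₀ _ hN'] at this
  constructor
  · rw [hx, add_sub_cancel_right]
    exact hvb _
  · rw [hev.deriv_eq, (hw x).deriv, add_sub_cancel_right, abs_mul, Nat.abs_cast]
    gcongr
    exact hψb _

theorem IsSubdivisionLimit.differentiable {N : ℕ} (hN : 0 < N) {d : ℤ → ℝ} {u : ℝ → ℝ}
    (hu : IsSubdivisionLimit N d u) : Differentiable ℝ u := by
  obtain ⟨v, hv, hvl⟩ := exists_isSubdivisionLimit hN d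
  rwa [hu.unique hN hvl]

theorem node_injective {N : ℕ} (hN : 0 < N) : Function.Injective (node N) := by
  intro i j h
  have hN' : (N : ℝ) ≠ 0 := by positivity
  simp only [node] at h
  field_simp at h
  exact_mod_cast h

theorem degree_cubic_lt {N : ℕ} (hN : 0 < N) (F : ℤ → ℝ) (m : ℤ) : (cubic N F m).degree < 4 := by
  have h := Lagrange.degree_interpolate_lt (s := Finset.Icc m (m + 3)) F
    ((node_injective hN).injOn (s := ↑(Finset.Icc m (m + 3))))
  have hc : (Finset.Icc m (m + 3)).card = 4 := by
    rw [Int.card_Icc]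
    omega
  rw [hc] at h
  exact_mod_cast h

theorem eval_cubic_node {N : ℕ} (hN : 0 < N) (F : ℤ → ℝ) {m i : ℤ} (hi : m ≤ i)
    (hi' : i ≤ m + 3) : (cubic N F m).eval (node N i) = F i :=
  Lagrange.eval_interpolate_at_node F ((node_injective hN).injOn (s := ↑(Finset.Icc m (m + 3))))
    (Finset.mem_Icc.mpr ⟨hi, hi'⟩)

theorem cubic_eq_of_degree_lt {N : ℕ} (hN : 0 < N) {F : ℤ → ℝ} {m : ℤ} {q : ℝ[X]}
    (hq : q.degree < 4) (h : ∀ i, m ≤ i → i ≤ m + 3 → q.eval (node N i) = F i) :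
    cubic N F m = q := by
  refine (Lagrange.eq_interpolate_of_eval_eq F
    ((node_injective hN).injOn (s := ↑(Finset.Icc m (m + 3)))) ?_ fun i hi => ?_).symm
  · have hc : (Finset.Icc m (m + 3)).card = 4 := by
      rw [Int.card_Icc]
      omega
    rw [hc]
    exact_mod_cast hq
  · rw [Finset.mem_Icc] at hi
    exact h i hi.1 hi.2

/-- Newton's form of the interpolating cubic. -/
theorem eval_cubic {N : ℕ} (hN : 0 < N) (F : ℤ → ℝ) (m : ℤ) (x : ℝ) :
    (cubic N F m).eval x = F m + (x * N - m) * (F (m + 1) - F m) +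
      (x * N - m) * (x * N - m - 1) / 2 * (F (m + 2) - 2 * F (m + 1) + F m) +
      (x * N - m) * (x * N - m - 1) * (x * N - m - 2) / 6 *
        (F (m + 3) - 3 * F (m + 2) + 3 * F (m + 1) - F m) := by
  have hN' : (N : ℝ) ≠ 0 := by positivity
  set T : ℝ[X] := C (N : ℝ) * X - C (m : ℝ) with hT
  set Q : ℝ[X] := C (F m) + T * C (F (m + 1) - F m) +
    T * (T - C 1) * C ((F (m + 2) - 2 * F (m + 1) + F m) / 2) +
    T * (T - C 1) * (T - C 2) * C ((F (m + 3) - 3 * F (m + 2) + 3 * F (m + 1) - F m) / 6) with hQ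
  have hQe : ∀ z, Q.eval z = F m + (z * N - m) * (F (m + 1) - F m) +
      (z * N - m) * (z * N - m - 1) / 2 * (F (m + 2) - 2 * F (m + 1) + F m) +
      (z * N - m) * (z * N - m - 1) * (z * N - m - 2) / 6 *
        (F (m + 3) - 3 * F (m + 2) + 3 * F (m + 1) - F m) := by
    intro z
    simp only [hQ, hT, eval_add, eval_mul, eval_sub, eval_C, eval_X]
    ring
  have hdeg : Q.degree < 4 := by
    have : Q.degree ≤ 3 := by
      rw [hQ, hT]
      compute_degree
    exact this.trans_lt (by norm_num)
  rw [cubic_eq_of_degree_lt hN hdeg, hQe]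
  intro i hi hi'
  rw [hQe, node, div_mul_cancel₀ _ hN']
  rcases (by omega : i = m ∨ i = m + 1 ∨ i = m + 2 ∨ i = m + 3) with rfl | rfl | rfl | rfl <;>
  · push_cast
    ring

theorem abs_eval_cubic_le {N : ℕ} (hN : 0 < N) {e : ℤ → ℝ} {m : ℤ} {ε : ℝ}
    (he : ∀ i, m ≤ i → i ≤ m + 3 → |e i| ≤ ε) {x : ℝ} (hx : |x * N - m| ≤ 30) :
    |(cubic N e m).eval x| ≤ 50000 * ε := by
  rw [eval_cubic hN]
  have h0 := he m (by omega) (by omega)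
  have h1 := he (m + 1) (by omega) (by omega)
  have h2 := he (m + 2) (by omega) (by omega)
  have h3 := he (m + 3) (by omega) (by omega)
  have hε : 0 ≤ ε := (abs_nonneg _).trans h0
  generalize x * N - m = t at *
  rw [abs_le] at h0 h1 h2 h3 hx
  have t1 : |t * (e (m + 1) - e m)| ≤ 30 * (2 * ε) := by
    rw [abs_mul]
    gcongr
    · exact abs_le.mpr hx
    · rw [abs_le]
      constructor <;> linarith
  have hta : |t - 1| ≤ 31 := abs_le.mpr ⟨by linarith, by linarith⟩
  have htb : |t - 2| ≤ 32 := abs_le.mpr ⟨by linarith, by linarith⟩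
  have t2 : |t * (t - 1) / 2 * (e (m + 2) - 2 * e (m + 1) + e m)| ≤ 30 * 31 / 2 * (4 * ε) := by
    rw [abs_mul, abs_div, abs_mul, abs_two]
    gcongr
    · exact abs_le.mpr hx
    · rw [abs_le]
      constructor <;> linarith
  have t3 : |t * (t - 1) * (t - 2) / 6 *
      (e (m + 3) - 3 * e (m + 2) + 3 * e (m + 1) - e m)| ≤ 30 * 31 * 32 / 6 * (8 * ε) := by
    rw [abs_mul, abs_div, abs_mul, abs_mul, abs_of_pos (by norm_num : (0 : ℝ) < 6)]
    gcongr
    · exact abs_le.mpr hx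
    · rw [abs_le]
      constructor <;> linarith
  rw [abs_le] at t1 t2 t3 ⊢
  constructor <;> linarith

theorem abs_eval_cubic_sub_le {N : ℕ} (hN : 0 < N) {e : ℤ → ℝ} {m : ℤ} {ε : ℝ}
    (he : ∀ i, m ≤ i → i ≤ m + 3 → |e i| ≤ ε) {x y : ℝ} (hx : |x * N - m| ≤ 30)
    (hy : |y * N - m| ≤ 30) :
    |(cubic N e m).eval x - (cubic N e m).eval y| ≤ 50000 * ε * N * |x - y| := by
  rw [eval_cubic hN, eval_cubic hN]
  have h0 := he m (by omega) (by omega)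
  have h1 := he (m + 1) (by omega) (by omega)
  have h2 := he (m + 2) (by omega) (by omega)
  have h3 := he (m + 3) (by omega) (by omega)
  have hε : 0 ≤ ε := (abs_nonneg _).trans h0
  have hts : |x * N - m - (y * N - m)| = N * |x - y| := by
    rw [← Nat.abs_cast (R := ℝ) N, ← abs_mul, Nat.abs_cast]
    congr 1
    ring
  rw [mul_assoc _ (N : ℝ), ← hts]
  generalize x * N - m = t at *
  generalize y * N - m = r at *
  rw [abs_le] at h0 h1 h2 h3 hx hy
  set A := e (m + 1) - e m with hA
  set B := e (m + 2) - 2 * e (m + 1) + e m with hB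
  set D := e (m + 3) - 3 * e (m + 2) + 3 * e (m + 1) - e m with hD
  have hAb : |A| ≤ 2 * ε := abs_le.mpr ⟨by linarith, by linarith⟩
  have hBb : |B| ≤ 4 * ε := abs_le.mpr ⟨by linarith, by linarith⟩
  have hDb : |D| ≤ 8 * ε := abs_le.mpr ⟨by linarith, by linarith⟩
  have e1 : e m + t * A + t * (t - 1) / 2 * B + t * (t - 1) * (t - 2) / 6 * D -
      (e m + r * A + r * (r - 1) / 2 * B + r * (r - 1) * (r - 2) / 6 * D) =
      (A + (t + r - 1) / 2 * B + (t ^ 2 + t * r + r ^ 2 - 3 * (t + r) + 2) / 6 * D) *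
        (t - r) := by ring
  rw [e1, abs_mul]
  refine mul_le_mul_of_nonneg_right ?_ (abs_nonneg _)
  have t2 : |(t + r - 1) / 2 * B| ≤ 61 / 2 * (4 * ε) := by
    rw [abs_mul]
    gcongr
    rw [abs_le]
    constructor <;> linarith
  have t3 : |(t ^ 2 + t * r + r ^ 2 - 3 * (t + r) + 2) / 6 * D| ≤ 500 * (8 * ε) := by
    rw [abs_mul]
    gcongr
    rw [abs_le]
    constructor <;> nlinarith [hx.1, hx.2, hy.1, hy.2]
  rw [abs_le] at hAb t2 t3 ⊢
  constructor <;> linarith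

theorem cubic_sub_eq {N : ℕ} (hN : 0 < N) (F : ℤ → ℝ) (m : ℤ) {q : ℝ[X]} (hq : q.degree < 4) :
    cubic N F m - q = cubic N (fun i => F i - q.eval (node N i)) m := by
  refine (cubic_eq_of_degree_lt hN ?_ fun i hi hi' => ?_).symm
  · exact (degree_sub_le _ _).trans_lt (max_lt (degree_cubic_lt hN F m) hq)
  · rw [eval_sub, eval_cubic_node hN F hi hi']

/-- A cubic Taylor polynomial at `y` of a primitive `F` of `g` on `I`, with bounds by `K` for the
remainder and for the Lipschitz constants of the polynomial and its derivative. -/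
structure IsTaylorModel (F g : ℝ → ℝ) (I : Set ℝ) (K y : ℝ) (q : ℝ[X]) : Prop where
  degree_lt : q.degree < 4
  eval_self : q.eval y = F y
  eval_derivative_self : q.derivative.eval y = g y
  abs_sub_le : ∀ x ∈ I, |F x - q.eval x| ≤ K * |x - y| ^ 4
  lipschitz : ∀ x z : ℝ, |x| ≤ 2 → |z| ≤ 2 → |q.eval x - q.eval z| ≤ K * |x - z|
  lipschitz_derivative : ∀ x z : ℝ, |x| ≤ 2 → |z| ≤ 2 →
    |q.derivative.eval x - q.derivative.eval z| ≤ K * |x - z|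

theorem abs_sub_eval_le_of_deriv {H h : ℝ → ℝ} {I : Set ℝ} (hI : Convex ℝ I)
    (hH : ∀ x ∈ I, HasDerivWithinAt H (h x) I x) {p : ℝ[X]} {y K : ℝ} {n : ℕ} (hK : 0 ≤ K)
    (hy : y ∈ I) (hp : p.eval y = H y)
    (hb : ∀ x ∈ I, |h x - p.derivative.eval x| ≤ K * |x - y| ^ n) {x : ℝ} (hx : x ∈ I) :
    |H x - p.eval x| ≤ K * |x - y| ^ (n + 1) := by
  have hsub : Set.uIcc y x ⊆ I := by
    rw [← segment_eq_uIcc]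
    exact hI.segment_subset hy hx
  have key := Convex.norm_image_sub_le_of_norm_hasDerivWithin_le
    (f := fun z => H z - p.eval z) (f' := fun z => h z - p.derivative.eval z)
    (s := Set.uIcc y x) (C := K * |x - y| ^ n) (x := y) (y := x)
    (fun z hz => ((hH z (hsub hz)).mono hsub).sub (p.hasDerivAt z).hasDerivWithinAt)
    (fun z hz => (hb z (hsub hz)).trans (by
      have := Set.abs_sub_left_of_mem_uIcc hz
      gcongr K * ?_ ^ n))
    (convex_uIcc _ _) Set.left_mem_uIcc Set.right_mem_uIcc
  simp only [hp, sub_self, sub_zero, Real.norm_eq_abs] at key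
  rw [pow_succ, ← mul_assoc]
  exact key

theorem abs_eval_sub_eval_le (p : ℝ[X]) {B : ℝ}
    (hB : ∀ z, |z| ≤ 2 → |p.derivative.eval z| ≤ B) {x z : ℝ} (hx : |x| ≤ 2) (hz : |z| ≤ 2) :
    |p.eval x - p.eval z| ≤ B * |x - z| :=
  Convex.norm_image_sub_le_of_norm_hasDerivWithin_le (s := Set.Icc (-2) 2)
    (fun w _ => (p.hasDerivAt w).hasDerivWithinAt) (fun w hw => hB w (abs_le.mpr hw))
    (convex_Icc _ _) (abs_le.mp hz) (abs_le.mp hx)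

theorem exists_isTaylorModel {α β : ℝ} (hα : 0 ≤ α) (hαβ : α < β) (hβ : β ≤ 1) {F g : ℝ → ℝ}
    (hg : ContDiffOn ℝ 3 g (Set.Icc α β))
    (hF : ∀ x ∈ Set.Icc α β, HasDerivWithinAt F (g x) (Set.Icc α β) x) :
    ∃ K, 0 ≤ K ∧ ∀ y ∈ Set.Icc α β, ∃ q, IsTaylorModel F g (Set.Icc α β) K y q := by
  set I := Set.Icc α β with hI
  have hU : UniqueDiffOn ℝ I := uniqueDiffOn_Icc hαβ
  set D : ℕ → ℝ → ℝ := fun i => iteratedDerivWithin i g I with hD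
  have hD0 : D 0 = g := iteratedDerivWithin_zero
  have hder : ∀ i : ℕ, i < 3 → ∀ x ∈ I, HasDerivWithinAt (D i) (D (i + 1) x) I x := by
    intro i hi x hx
    have h := (hg.differentiableOn_iteratedDerivWithin (m := i) (by exact_mod_cast hi) hU) x hx
    simp only [hD, iteratedDerivWithin_succ]
    exact h.hasDerivWithinAt
  have hbd : ∀ i : ℕ, i ≤ 3 → ∃ B, ∀ x ∈ I, |D i x| ≤ B := by
    intro i hi
    exact isCompact_Icc.exists_bound_of_continuousOn
      (hg.continuousOn_iteratedDerivWithin (by exact_mod_cast hi) hU)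
  obtain ⟨B0, hB0⟩ := hbd 0 (by norm_num)
  obtain ⟨B1, hB1⟩ := hbd 1 (by norm_num)
  obtain ⟨B2, hB2⟩ := hbd 2 (by norm_num)
  obtain ⟨B3, hB3⟩ := hbd 3 (by norm_num)
  have hαI : α ∈ I := ⟨le_rfl, hαβ.le⟩
  have p0 := (abs_nonneg _).trans (hB0 α hαI)
  have p1 := (abs_nonneg _).trans (hB1 α hαI)
  have p2 := (abs_nonneg _).trans (hB2 α hαI)
  have p3 := (abs_nonneg _).trans (hB3 α hαI)
  set B := B0 + B1 + B2 + B3 with hB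
  refine ⟨10 * B, by positivity, fun y hy => ?_⟩
  have b0 : |D 0 y| ≤ B := (hB0 y hy).trans (by linarith)
  have b1 : |D 1 y| ≤ B := (hB1 y hy).trans (by linarith)
  have b2 : |D 2 y| ≤ B := (hB2 y hy).trans (by linarith)
  have hBnn : 0 ≤ B := by positivity
  set q : ℝ[X] := C (F y) + C (D 0 y) * (X - C y) + C (D 1 y / 2) * (X - C y) ^ 2 +
    C (D 2 y / 6) * (X - C y) ^ 3 with hq
  have hq1 : ∀ x, q.derivative.eval x = D 0 y + D 1 y * (x - y) + D 2 y / 2 * (x - y) ^ 2 := by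
    intro x
    simp [hq, derivative_pow]
    ring
  have hq2 : ∀ x, q.derivative.derivative.eval x = D 1 y + D 2 y * (x - y) := by
    intro x
    simp [hq, derivative_pow]
    ring
  have hq3 : ∀ x, q.derivative.derivative.derivative.eval x = D 2 y := by
    intro x
    simp [hq, derivative_pow]
    ring
  have hq4 : ∀ x, q.derivative.derivative.derivative.derivative.eval x = 0 := by
    intro x
    simp [hq, derivative_pow]
  have hcI : Convex ℝ I := convex_Icc _ _
  have s3 : ∀ x ∈ I, |D 2 x - q.derivative.derivative.derivative.eval x| ≤ B * |x - y| ^ 1 :=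
    fun x hx => abs_sub_eval_le_of_deriv (n := 0) hcI (hder 2 (by norm_num)) hBnn hy (hq3 y)
      (fun z hz => by
        rw [hq4, sub_zero, pow_zero, mul_one]
        exact (hB3 z hz).trans (by linarith)) hx
  have s2 : ∀ x ∈ I, |D 1 x - q.derivative.derivative.eval x| ≤ B * |x - y| ^ 2 :=
    fun x hx => abs_sub_eval_le_of_deriv hcI (hder 1 (by norm_num)) hBnn hy (by simp [hq2]) s3 hx
  have s1 : ∀ x ∈ I, |D 0 x - q.derivative.eval x| ≤ B * |x - y| ^ 3 :=
    fun x hx => abs_sub_eval_le_of_deriv hcI (hder 0 (by norm_num)) hBnn hy (by simp [hq1]) s2 hx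
  have hqy : q.eval y = F y := by simp [hq]
  have s0 : ∀ x ∈ I, |F x - q.eval x| ≤ B * |x - y| ^ 4 :=
    fun x hx => abs_sub_eval_le_of_deriv hcI (by rwa [hD0]) hBnn hy hqy s1 hx
  have hy1 : |y| ≤ 1 := abs_le.mpr ⟨by linarith [hy.1], by linarith [hy.2]⟩
  have hxy : ∀ x : ℝ, |x| ≤ 2 → |x - y| ≤ 3 := fun x hx => by
    have := abs_sub x y
    linarith
  have hq1y : q.derivative.eval y = g y := by simp [hq1, hD0]
  refine ⟨q, ?_, hqy, hq1y, fun x hx => (s0 x hx).trans ?_, fun x z hx hz => ?_,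
    fun x z hx hz => ?_⟩
  · have : q.degree ≤ 3 := by
      rw [hq]
      compute_degree
    exact this.trans_lt (by norm_num)
  · gcongr
    linarith
  · refine abs_eval_sub_eval_le q (fun w hw => ?_) hx hz
    have hw3 := hxy w hw
    rw [hq1]
    have t1 : |D 1 y * (w - y)| ≤ B * 3 := by
      rw [abs_mul]
      gcongr
    have t2 : |D 2 y / 2 * (w - y) ^ 2| ≤ B / 2 * 3 ^ 2 := by
      rw [abs_mul, abs_div, abs_two, abs_pow]
      gcongr
    rw [abs_le] at b0 t1 t2 ⊢
    constructor <;> linarith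
  · refine abs_eval_sub_eval_le q.derivative (fun w hw => ?_) hx hz
    have hw3 := hxy w hw
    rw [hq2]
    have t1 : |D 2 y * (w - y)| ≤ B * 3 := by
      rw [abs_mul]
      gcongr
    rw [abs_le] at b1 t1 ⊢
    constructor <;> linarith

theorem intervalIntegrable_of_eqOn_Ioo {f g : ℝ → ℝ} {α β : ℝ} (hαβ : α ≤ β)
    (hg : ContinuousOn g (Set.Icc α β)) (h : Set.EqOn f g (Set.Ioo α β)) :
    IntervalIntegrable f MeasureTheory.volume α β := by
  refine IntervalIntegrable.congr_uIoo (f := g) (hg.intervalIntegrable_of_Icc hαβ) ?_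
  rw [Set.uIoo_of_le hαβ]
  exact h.symm

theorem hasDerivWithinAt_integral_of_eqOn_Ioo {f g : ℝ → ℝ} {α β : ℝ} (hαβ : α ≤ β)
    (hg : ContinuousOn g (Set.Icc α β)) (h : Set.EqOn f g (Set.Ioo α β)) {x : ℝ}
    (hx : x ∈ Set.Icc α β) :
    HasDerivWithinAt (fun x => ∫ y in α..x, f y) (g x) (Set.Icc α β) x := by
  set G : ℝ → ℝ := Set.IccExtend hαβ ((Set.Icc α β).domRestrict g) with hG
  have hGc : Continuous G := (continuousOn_iff_continuous_domRestrict.mp hg).Icc_extend'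
  have hGg : ∀ z ∈ Set.Icc α β, G z = g z := fun z hz => by
    rw [hG, Set.IccExtend_of_mem _ _ hz, Set.domRestrict_apply]
  have hint : ∀ z ∈ Set.Icc α β, ∫ y in α..z, f y = ∫ y in α..z, G y := fun z hz =>
    intervalIntegral.integral_congr_Ioo_of_le hz.1 fun w hw => by
      rw [h ⟨hw.1, hw.2.trans_le hz.2⟩, hGg w ⟨hw.1.le, hw.2.le.trans hz.2⟩]
  have hd : HasDerivAt (fun x => ∫ y in α..x, G y) (G x) x :=
    intervalIntegral.integral_hasDerivAt_right (hGc.intervalIntegrable _ _)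
      (hGc.stronglyMeasurableAtFilter _ _) hGc.continuousAt
  rw [hGg x hx] at hd
  exact hd.hasDerivWithinAt.congr (fun z hz => hint z hz) (hint x hx)

/-- The cell averages determine the primitive of `f` at the grid points. -/
theorem primitiveData_cellAverage {f : ℝ → ℝ} {N : ℕ} (hN : 0 < N)
    (hf : IntervalIntegrable f MeasureTheory.volume 0 1) {j : ℤ} (hj : 0 ≤ j) (hj' : j ≤ N) :
    primitiveData N (cellAverage f N) j = ∫ y in (0 : ℝ)..node N j, f y := by
  have hN' : (0 : ℝ) < N := by positivity
  have hsub : ∀ i : ℤ, 0 ≤ i → i ≤ N → node N i ∈ Set.Icc (0 : ℝ) 1 := fun i h0 h1 => by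
    have h0' : (0 : ℝ) ≤ i := by exact_mod_cast h0
    have h1' : (i : ℝ) ≤ N := by exact_mod_cast h1
    exact ⟨by rw [node]; positivity, by rw [node]; exact (div_le_one hN').mpr h1'⟩
  have hint : ∀ i k : ℤ, 0 ≤ i → i ≤ N → 0 ≤ k → k ≤ N →
      IntervalIntegrable f MeasureTheory.volume (node N i) (node N k) := fun i k h1 h2 h3 h4 => by
    refine hf.mono_set ?_
    rw [Set.uIcc_of_le zero_le_one]
    exact Set.uIcc_subset_Icc (hsub i h1 h2) (hsub k h3 h4)
  have hn0 : node N 0 = 0 := by simp [node]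
  rw [primitiveData, if_pos ⟨hj, hj'⟩]
  obtain ⟨n, rfl⟩ := Int.eq_ofNat_of_zero_le hj
  clear hj
  induction n with
  | zero => simp [hn0]
  | succ n ih =>
    have ih' := ih (by push_cast at hj'; omega)
    push_cast at hj' ⊢
    have hI : Finset.Icc (1 : ℤ) (n + 1) = insert ((n : ℤ) + 1) (Finset.Icc (1 : ℤ) n) := by
      ext i
      simp only [Finset.mem_Icc, Finset.mem_insert]
      omega
    have hadd := intervalIntegral.integral_add_adjacent_intervals
      (hint 0 n le_rfl (by omega) (by omega) (by omega))
      (hint n (n + 1) (by omega) (by omega) (by omega) (by omega))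
    rw [hn0] at hadd
    rw [hI, Finset.sum_insert (by simp), mul_add, ih', cellAverage, add_sub_cancel_right, ← hadd]
    field_simp
    ring

/-- `Φ` is a continuous function which on `[0,s]` and on `[s,1]` has cubic Taylor models with
derivatives `fm` and `fp`, respectively. -/
structure HasJumpModel (Φ fm fp : ℝ → ℝ) (s K : ℝ) : Prop where
  pos : 0 < s
  lt_one : s < 1
  nonneg : 0 ≤ K
  left : ∀ y ∈ Set.Icc 0 s, ∃ q, IsTaylorModel Φ fm (Set.Icc 0 s) K y q
  right : ∀ y ∈ Set.Icc s 1, ∃ q, IsTaylorModel Φ fp (Set.Icc s 1) K y q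

theorem IsTaylorModel.mono {F g : ℝ → ℝ} {I : Set ℝ} {K K' y : ℝ} {q : ℝ[X]}
    (M : IsTaylorModel F g I K y q) (h : K ≤ K') : IsTaylorModel F g I K' y q where
  degree_lt := M.degree_lt
  eval_self := M.eval_self
  eval_derivative_self := M.eval_derivative_self
  abs_sub_le x hx := (M.abs_sub_le x hx).trans (by gcongr)
  lipschitz x z hx hz := (M.lipschitz x z hx hz).trans (by gcongr)
  lipschitz_derivative x z hx hz := (M.lipschitz_derivative x z hx hz).trans (by gcongr)

theorem exists_hasJumpModel {f fm fp : ℝ → ℝ} {s : ℝ} (hs : s ∈ Set.Ioo (0 : ℝ) 1)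
    (hfm : ContDiffOn ℝ 3 fm (Set.Icc 0 s)) (hfp : ContDiffOn ℝ 3 fp (Set.Icc s 1))
    (hm : Set.EqOn f fm (Set.Ico 0 s)) (hp : Set.EqOn f fp (Set.Ioc s 1)) :
    IntervalIntegrable f MeasureTheory.volume 0 1 ∧
      ∃ K, HasJumpModel (fun x => ∫ y in (0 : ℝ)..x, f y) fm fp s K := by
  have hm' : Set.EqOn f fm (Set.Ioo 0 s) := hm.mono Set.Ioo_subset_Ico_self
  have hp' : Set.EqOn f fp (Set.Ioo s 1) := hp.mono Set.Ioo_subset_Ioc_self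
  have hi0 := intervalIntegrable_of_eqOn_Ioo hs.1.le hfm.continuousOn hm'
  have hi1 := intervalIntegrable_of_eqOn_Ioo hs.2.le hfp.continuousOn hp'
  refine ⟨hi0.trans hi1, ?_⟩
  obtain ⟨K0, hK0, h0⟩ := exists_isTaylorModel le_rfl hs.1 hs.2.le hfm
    (fun x hx => hasDerivWithinAt_integral_of_eqOn_Ioo hs.1.le hfm.continuousOn hm' hx)
  obtain ⟨K1, hK1, h1⟩ := exists_isTaylorModel (F := fun x => ∫ y in (0 : ℝ)..x, f y)
    hs.1.le hs.2 le_rfl hfp (fun x hx => by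
      have hd := (hasDerivWithinAt_integral_of_eqOn_Ioo hs.2.le hfp.continuousOn hp' hx).const_add
        (∫ y in (0 : ℝ)..s, f y)
      have he : ∀ z ∈ Set.Icc s 1, ∫ y in (0 : ℝ)..z, f y =
          (∫ y in (0 : ℝ)..s, f y) + ∫ y in s..z, f y := fun z hz =>
        (intervalIntegral.integral_add_adjacent_intervals hi0 (hi1.mono_set (by
          rw [Set.uIcc_of_le hs.2.le]
          exact Set.uIcc_subset_Icc ⟨le_rfl, hs.2.le⟩ hz))).symm
      exact hd.congr he (he x hx))
  refine ⟨K0 + K1, hs.1, hs.2, by positivity, fun y hy => ?_, fun y hy => ?_⟩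
  · obtain ⟨q, hq⟩ := h0 y hy
    exact ⟨q, hq.mono (by linarith)⟩
  · obtain ⟨q, hq⟩ := h1 y hy
    exact ⟨q, hq.mono (by linarith)⟩

theorem abs_eval_sub_linear_le {q : ℝ[X]} {K x y : ℝ} (hK : 0 ≤ K)
    (h : ∀ x z : ℝ, |x| ≤ 2 → |z| ≤ 2 →
      |q.derivative.eval x - q.derivative.eval z| ≤ K * |x - z|)
    (hx : |x| ≤ 2) (hy : |y| ≤ 2) :
    |q.eval x - q.eval y - q.derivative.eval y * (x - y)| ≤ K * |x - y| ^ 2 := by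
  have key := abs_sub_eval_le_of_deriv (H := q.eval) (h := q.derivative.eval)
    (I := Set.Icc (-2) 2) (convex_Icc _ _) (fun z _ => (q.hasDerivAt z).hasDerivWithinAt)
    (p := C (q.eval y) + C (q.derivative.eval y) * (X - C y)) (y := y) (n := 1) hK (abs_le.mp hy)
    (by simp) (fun z hz => by
      have := h z y (abs_le.mpr hz) hy
      simpa using this) (abs_le.mp hx)
  simp only [eval_add, eval_C, eval_mul, eval_sub, eval_X] at key
  rwa [sub_add_eq_sub_sub] at key

theorem IsTaylorModel.abs_sub_linear_le {F g : ℝ → ℝ} {I : Set ℝ} {K y : ℝ} {q : ℝ[X]}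
    (M : IsTaylorModel F g I K y q) (hK : 0 ≤ K) (hI : I ⊆ Set.Icc 0 1) (hy : y ∈ I) {x : ℝ}
    (hx : x ∈ I) : |F x - F y - g y * (x - y)| ≤ 2 * K * |x - y| ^ 2 := by
  have hx1 := hI hx
  have hy1 := hI hy
  have h1 := M.abs_sub_le x hx
  have h2 := abs_eval_sub_linear_le hK M.lipschitz_derivative (x := x) (y := y)
    (abs_le.mpr ⟨by linarith [hx1.1], by linarith [hx1.2]⟩)
    (abs_le.mpr ⟨by linarith [hy1.1], by linarith [hy1.2]⟩)
  rw [M.eval_self, M.eval_derivative_self] at h2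
  have hle : |x - y| ≤ 1 := abs_le.mpr ⟨by linarith [hx1.1, hy1.2], by linarith [hx1.2, hy1.1]⟩
  have h3 : K * |x - y| ^ 4 ≤ K * |x - y| ^ 2 := by
    gcongr K * ?_
    exact pow_le_pow_of_le_one (abs_nonneg _) hle (by norm_num)
  rw [abs_le] at h1 h2 ⊢
  constructor <;> linarith

theorem IsTaylorModel.abs_sub_le_of_mem {F g : ℝ → ℝ} {I : Set ℝ} {K y : ℝ} {q : ℝ[X]}
    (M : IsTaylorModel F g I K y q) (hK : 0 ≤ K) (hI : I ⊆ Set.Icc 0 1) (hy : y ∈ I) {x : ℝ}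
    (hx : x ∈ I) : |F x - F y| ≤ 2 * K * |x - y| := by
  have hx1 := hI hx
  have hy1 := hI hy
  have h1 := M.abs_sub_le x hx
  have h2 := M.lipschitz x y
    (abs_le.mpr ⟨by linarith [hx1.1], by linarith [hx1.2]⟩)
    (abs_le.mpr ⟨by linarith [hy1.1], by linarith [hy1.2]⟩)
  rw [M.eval_self] at h2
  have hle : |x - y| ≤ 1 := abs_le.mpr ⟨by linarith [hx1.1, hy1.2], by linarith [hx1.2, hy1.1]⟩
  have h3 : K * |x - y| ^ 4 ≤ K * |x - y| := by
    gcongr K * ?_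
    exact pow_le_of_le_one (abs_nonneg _) hle (by norm_num)
  rw [abs_le] at h1 h2 ⊢
  constructor <;> linarith

section

variable {Φ fm fp : ℝ → ℝ} {s K : ℝ}

theorem HasJumpModel.Icc_left_subset (hJ : HasJumpModel Φ fm fp s K) :
    Set.Icc 0 s ⊆ Set.Icc (0 : ℝ) 1 := Set.Icc_subset_Icc_right hJ.lt_one.le

theorem HasJumpModel.Icc_right_subset (hJ : HasJumpModel Φ fm fp s K) :
    Set.Icc s 1 ⊆ Set.Icc (0 : ℝ) 1 := Set.Icc_subset_Icc_left hJ.pos.le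

theorem HasJumpModel.mem_left (hJ : HasJumpModel Φ fm fp s K) : s ∈ Set.Icc 0 s :=
  ⟨hJ.pos.le, le_rfl⟩

theorem HasJumpModel.mem_right (hJ : HasJumpModel Φ fm fp s K) : s ∈ Set.Icc s 1 :=
  ⟨le_rfl, hJ.lt_one.le⟩

theorem HasJumpModel.abs_sub_singular_le (hJ : HasJumpModel Φ fm fp s K) {x : ℝ}
    (hx : x ∈ Set.Icc (0 : ℝ) 1) : |Φ x - Φ s| ≤ 2 * K * |x - s| := by
  rcases le_total x s with h | h
  · obtain ⟨q, M⟩ := hJ.left s hJ.mem_left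
    exact M.abs_sub_le_of_mem hJ.nonneg hJ.Icc_left_subset hJ.mem_left ⟨hx.1, h⟩
  · obtain ⟨q, M⟩ := hJ.right s hJ.mem_right
    exact M.abs_sub_le_of_mem hJ.nonneg hJ.Icc_right_subset hJ.mem_right ⟨h, hx.2⟩

theorem node_eq_mul (N : ℕ) (i : ℤ) : node N i = i * (1 / (N : ℝ)) := by
  rw [node]
  ring

theorem node_add_one (N : ℕ) (i : ℤ) : node N (i + 1) = node N i + 1 / (N : ℝ) := by
  rw [node_eq_mul, node_eq_mul]
  push_cast
  ring

theorem node_sub_one (N : ℕ) (i : ℤ) : node N (i - 1) = node N i - 1 / (N : ℝ) := by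
  rw [node_eq_mul, node_eq_mul]
  push_cast
  ring

/-- Away from the jump, second differences are of second order. -/
theorem HasJumpModel.abs_secondDiff_le (hJ : HasJumpModel Φ fm fp s K) {N : ℕ} {F : ℤ → ℝ}
    (hF : ∀ j, node N j ∈ Set.Icc (0 : ℝ) 1 → F j = Φ (node N j)) {k : ℤ}
    (h0 : 0 ≤ node N (k - 1)) (h1 : node N (k + 1) ≤ 1) (hk : 1 / (N : ℝ) ≤ |node N k - s|) :
    |secondDiff F k| ≤ 4 * K * (1 / (N : ℝ)) ^ 2 := by
  have hh : 0 ≤ 1 / (N : ℝ) := by positivity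
  rw [secondDiff]
  rw [node_sub_one] at h0
  rw [node_add_one] at h1
  have e1 : F (k - 1) = Φ (node N k - 1 / N) := by
    rw [hF, node_sub_one]
    rw [node_sub_one]
    exact ⟨h0, by linarith⟩
  have e2 : F (k + 1) = Φ (node N k + 1 / N) := by
    rw [hF, node_add_one]
    rw [node_add_one]
    exact ⟨by linarith, h1⟩
  rw [e1, e2, hF k ⟨by linarith, by linarith⟩]
  generalize node N k = x at *
  generalize 1 / (N : ℝ) = h at *
  have aux : ∀ (g : ℝ → ℝ) (I : Set ℝ), I ⊆ Set.Icc 0 1 → x ∈ I → x - h ∈ I → x + h ∈ I →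
      (∃ q, IsTaylorModel Φ g I K x q) → |Φ (x - h) - 2 * Φ x + Φ (x + h)| ≤ 4 * K * h ^ 2 := by
    rintro g I hI hx hl hr ⟨q, M⟩
    have hl' := M.abs_sub_linear_le hJ.nonneg hI hx hl
    have hr' := M.abs_sub_linear_le hJ.nonneg hI hx hr
    rw [sub_sub_cancel_left, abs_neg, sq_abs, abs_le] at hl'
    rw [add_sub_cancel_left, sq_abs, abs_le] at hr'
    rw [abs_le]
    constructor <;> linarith
  rcases le_total x s with hxs | hxs
  · rw [abs_of_nonpos (by linarith)] at hk
    exact aux fm _ hJ.Icc_left_subset ⟨by linarith, hxs⟩ ⟨by linarith, by linarith⟩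
      ⟨by linarith, by linarith⟩ (hJ.left x ⟨by linarith, hxs⟩)
  · rw [abs_of_nonneg (by linarith)] at hk
    exact aux fp _ hJ.Icc_right_subset ⟨hxs, by linarith⟩ ⟨by linarith, by linarith⟩
      ⟨by linarith, by linarith⟩ (hJ.right x ⟨hxs, by linarith⟩)

/-- Near the jump, second differences are those of a linear spline, up to second order. -/
theorem HasJumpModel.abs_secondDiff_sub_le (hJ : HasJumpModel Φ fm fp s K) {N : ℕ} {F : ℤ → ℝ}
    (hF : ∀ j, node N j ∈ Set.Icc (0 : ℝ) 1 → F j = Φ (node N j)) {k : ℤ}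
    (h0 : 0 ≤ node N (k - 1)) (h1 : node N (k + 1) ≤ 1) (hk : |node N k - s| ≤ 1 / (N : ℝ)) :
    |secondDiff F k - (fp s - fm s) * (1 / (N : ℝ) - |node N k - s|)| ≤
      20 * K * (1 / (N : ℝ)) ^ 2 := by
  have hh : 0 ≤ 1 / (N : ℝ) := by positivity
  rw [secondDiff]
  rw [node_sub_one] at h0
  rw [node_add_one] at h1
  have e1 : F (k - 1) = Φ (node N k - 1 / N) := by
    rw [hF, node_sub_one]
    rw [node_sub_one]
    exact ⟨h0, by linarith⟩
  have e2 : F (k + 1) = Φ (node N k + 1 / N) := by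
    rw [hF, node_add_one]
    rw [node_add_one]
    exact ⟨by linarith, h1⟩
  rw [e1, e2, hF k ⟨by linarith, by linarith⟩]
  generalize node N k = x at *
  generalize 1 / (N : ℝ) = h at *
  have hK := hJ.nonneg
  obtain ⟨qm, Mm⟩ := hJ.left s hJ.mem_left
  obtain ⟨qp, Mp⟩ := hJ.right s hJ.mem_right
  have bm : ∀ z, 0 ≤ z → z ≤ s → |z - s| ≤ 2 * h → |Φ z - Φ s - fm s * (z - s)| ≤ 8 * K * h ^ 2 :=
    fun z hz0 hz1 hz =>
    (Mm.abs_sub_linear_le hK hJ.Icc_left_subset hJ.mem_left ⟨hz0, hz1⟩).trans (by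
      have : |z - s| ^ 2 ≤ (2 * h) ^ 2 := by gcongr
      nlinarith)
  have bp : ∀ z, s ≤ z → z ≤ 1 → |z - s| ≤ 2 * h → |Φ z - Φ s - fp s * (z - s)| ≤ 8 * K * h ^ 2 :=
    fun z hz0 hz1 hz =>
    (Mp.abs_sub_linear_le hK hJ.Icc_right_subset hJ.mem_right ⟨hz0, hz1⟩).trans (by
      have : |z - s| ^ 2 ≤ (2 * h) ^ 2 := by gcongr
      nlinarith)
  have b0 : ∀ z, |z - s| ≤ h → 2 * K * |z - s| ^ 2 ≤ 2 * K * h ^ 2 := fun z hz => by gcongr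
  have hxs := abs_le.mp hk
  have cl := bm (x - h) (by linarith) (by linarith) (abs_le.mpr ⟨by linarith, by linarith⟩)
  have cr := bp (x + h) (by linarith) (by linarith) (abs_le.mpr ⟨by linarith, by linarith⟩)
  rw [abs_le] at cl cr
  rcases le_total x s with hle | hle
  · have cx := (Mm.abs_sub_linear_le hK hJ.Icc_left_subset hJ.mem_left
      ⟨by linarith, hle⟩).trans (b0 x hk)
    rw [abs_le] at cx
    rw [abs_of_nonpos (by linarith : x - s ≤ 0), abs_le]
    constructor <;> nlinarith
  · have cx := (Mp.abs_sub_linear_le hK hJ.Icc_right_subset hJ.mem_right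
      ⟨hle, by linarith⟩).trans (b0 x hk)
    rw [abs_le] at cx
    rw [abs_of_nonneg (by linarith : 0 ≤ x - s), abs_le]
    constructor <;> nlinarith

end

theorem node_add_three (N : ℕ) (i : ℤ) : node N (i + 3) = node N i + 3 * (1 / (N : ℝ)) := by
  rw [node_eq_mul, node_eq_mul]
  push_cast
  ring

theorem node_sub_three (N : ℕ) (i : ℤ) : node N (i - 3) = node N i - 3 * (1 / (N : ℝ)) := by
  rw [node_eq_mul, node_eq_mul]
  push_cast
  ring

theorem node_mono (N : ℕ) : Monotone (node N) := fun i j h => by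
  rw [node, node]
  gcongr

/-- Interpolation error of a cubic near its nodes, in terms of a Taylor model. -/
theorem IsTaylorModel.abs_eval_cubic_sub_le {Φ g : ℝ → ℝ} {α β K y : ℝ} {q : ℝ[X]} {N : ℕ}
    (hN : 0 < N) (M : IsTaylorModel Φ g (Set.Icc α β) K y q) (hK : 0 ≤ K) {F : ℤ → ℝ}
    (hF : ∀ j, node N j ∈ Set.Icc α β → F j = Φ (node N j)) {m : ℤ} (hα : α ≤ node N m)
    (hβ : node N m + 3 * (1 / (N : ℝ)) ≤ β) (hm : |node N m - y| ≤ 25 * (1 / (N : ℝ))) :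
    (∀ x, |x - node N m| ≤ 30 * (1 / (N : ℝ)) →
      |(cubic N F m).eval x - q.eval x| ≤ 35000000000 * K * (1 / (N : ℝ)) ^ 4) ∧
    ∀ x z, |x - node N m| ≤ 30 * (1 / (N : ℝ)) → |z - node N m| ≤ 30 * (1 / (N : ℝ)) →
      |((cubic N F m).eval x - q.eval x) - ((cubic N F m).eval z - q.eval z)| ≤
        35000000000 * K * (1 / (N : ℝ)) ^ 3 * |x - z| := by
  have hN' : (0 : ℝ) < N := by positivity
  have hh : 0 < 1 / (N : ℝ) := by positivity
  have he : ∀ i, m ≤ i → i ≤ m + 3 →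
      |F i - q.eval (node N i)| ≤ 700000 * K * (1 / (N : ℝ)) ^ 4 := by
    intro i hi hi'
    have h1 := node_mono N hi
    have h2 := node_mono N hi'
    rw [node_add_three] at h2
    have hmem : node N i ∈ Set.Icc α β := ⟨by linarith, by linarith⟩
    rw [hF i hmem]
    have hd : |node N i - y| ≤ 28 * (1 / (N : ℝ)) := by
      rw [abs_le] at hm ⊢
      constructor <;> linarith
    calc _ ≤ K * |node N i - y| ^ 4 := M.abs_sub_le _ hmem
      _ ≤ K * (28 * (1 / (N : ℝ))) ^ 4 := by gcongr
      _ = 614656 * (K * (1 / (N : ℝ)) ^ 4) := by ring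
      _ ≤ 700000 * (K * (1 / (N : ℝ)) ^ 4) := by gcongr; norm_num
      _ = _ := by ring
  have hsc : ∀ x, |x - node N m| ≤ 30 * (1 / (N : ℝ)) → |x * N - m| ≤ 30 := by
    intro x hx
    have e : x * N - m = (x - node N m) * N := by
      rw [node, sub_mul, div_mul_cancel₀ _ hN'.ne']
    rw [e, abs_mul, Nat.abs_cast]
    calc _ ≤ 30 * (1 / (N : ℝ)) * N := by gcongr
      _ = 30 := by field_simp
  have hsub : ∀ x, (cubic N F m).eval x - q.eval x =
      (cubic N (fun i => F i - q.eval (node N i)) m).eval x := fun x => by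
    rw [← cubic_sub_eq hN F m M.degree_lt, eval_sub]
  constructor
  · intro x hx
    rw [hsub]
    exact (abs_eval_cubic_le hN he (hsc x hx)).trans (le_of_eq (by ring))
  · intro x z hx hz
    rw [hsub, hsub]
    refine (RC.abs_eval_cubic_sub_le hN he (hsc x hx) (hsc z hz)).trans (le_of_eq ?_)
    field_simp
    ring

section

variable {Φ fm fp : ℝ → ℝ} {s K : ℝ}

/-- The data `F` are the values of `Φ` on the grid, padded by zero, and the singularity `s` lies
in `[x_a, x_b]`, an interval of one or two cells away from the boundary. -/
structure IsGridSetting (Φ fm fp : ℝ → ℝ) (s K : ℝ) (N : ℕ) (F : ℤ → ℝ) (a b : ℤ) : Prop where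
  model : HasJumpModel Φ fm fp s K
  pos : 0 < N
  data : ∀ j, node N j ∈ Set.Icc (0 : ℝ) 1 → F j = Φ (node N j)
  data_of_neg : ∀ j, node N j < 0 → F j = 0
  data_of_one_lt : ∀ j, 1 < node N j → F j = 0
  cells : b = a + 1 ∨ b = a + 2
  mem : s ∈ Set.Icc (node N a) (node N b)
  margin_left : 10 * (1 / (N : ℝ)) ≤ s
  margin_right : s + 10 * (1 / (N : ℝ)) ≤ 1

variable {N : ℕ} {F : ℤ → ℝ} {a b : ℤ}

theorem IsGridSetting.step_pos (S : IsGridSetting Φ fm fp s K N F a b) : 0 < 1 / (N : ℝ) := by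
  have := S.pos
  positivity

theorem IsGridSetting.node_right_le (S : IsGridSetting Φ fm fp s K N F a b) :
    node N b ≤ node N a + 2 * (1 / (N : ℝ)) := by
  have h := S.step_pos
  rcases S.cells with rfl | rfl
  · rw [node_add_one]
    linarith
  · rw [show a + 2 = a + 1 + 1 by ring, node_add_one, node_add_one]
    linarith

/-- The left cubic approximates any left Taylor model near the singularity. -/
theorem IsGridSetting.leftCubic_near (S : IsGridSetting Φ fm fp s K N F a b) {y : ℝ} {q : ℝ[X]}
    (M : IsTaylorModel Φ fm (Set.Icc 0 s) K y q) (hy : |y - s| ≤ 15 * (1 / (N : ℝ))) :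
    (∀ x, |x - s| ≤ 15 * (1 / (N : ℝ)) →
      |(leftCubic N F a).eval x - q.eval x| ≤ 35000000000 * K * (1 / (N : ℝ)) ^ 4) ∧
    ∀ x z, |x - s| ≤ 15 * (1 / (N : ℝ)) → |z - s| ≤ 15 * (1 / (N : ℝ)) →
      |((leftCubic N F a).eval x - q.eval x) - ((leftCubic N F a).eval z - q.eval z)| ≤
        35000000000 * K * (1 / (N : ℝ)) ^ 3 * |x - z| := by
  have h := S.step_pos
  have hb := S.node_right_le
  have h1 := S.mem.1
  have h2 := S.mem.2
  have h3 := S.margin_left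
  have h4 := S.model.lt_one
  rw [abs_le] at hy
  have key := M.abs_eval_cubic_sub_le S.pos S.model.nonneg (F := F) (m := a - 3)
    (fun j hj => S.data j ⟨hj.1, by linarith [hj.2]⟩)
    (by rw [node_sub_three]; linarith) (by rw [node_sub_three]; linarith)
    (by rw [node_sub_three, abs_le]; constructor <;> linarith)
  rw [node_sub_three] at key
  have hx : ∀ x, |x - s| ≤ 15 * (1 / (N : ℝ)) →
      |x - (node N a - 3 * (1 / (N : ℝ)))| ≤ 30 * (1 / (N : ℝ)) := fun x hx => by
    rw [abs_le] at hx ⊢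
    constructor <;> linarith
  exact ⟨fun x hx' => key.1 x (hx x hx'), fun x z hx' hz' => key.2 x z (hx x hx') (hx z hz')⟩

/-- The right cubic approximates any right Taylor model near the singularity. -/
theorem IsGridSetting.rightCubic_near (S : IsGridSetting Φ fm fp s K N F a b) {y : ℝ} {q : ℝ[X]}
    (M : IsTaylorModel Φ fp (Set.Icc s 1) K y q) (hy : |y - s| ≤ 15 * (1 / (N : ℝ))) :
    (∀ x, |x - s| ≤ 15 * (1 / (N : ℝ)) →
      |(rightCubic N F b).eval x - q.eval x| ≤ 35000000000 * K * (1 / (N : ℝ)) ^ 4) ∧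
    ∀ x z, |x - s| ≤ 15 * (1 / (N : ℝ)) → |z - s| ≤ 15 * (1 / (N : ℝ)) →
      |((rightCubic N F b).eval x - q.eval x) - ((rightCubic N F b).eval z - q.eval z)| ≤
        35000000000 * K * (1 / (N : ℝ)) ^ 3 * |x - z| := by
  have h := S.step_pos
  have hb := S.node_right_le
  have h1 := S.mem.1
  have h2 := S.mem.2
  have h3 := S.margin_right
  have h4 := S.model.pos
  rw [abs_le] at hy
  have key := M.abs_eval_cubic_sub_le S.pos S.model.nonneg (F := F) (m := b)
    (fun j hj => S.data j ⟨by linarith [hj.1], hj.2⟩) (by linarith) (by linarith)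
    (by rw [abs_le]; constructor <;> linarith)
  have hx : ∀ x, |x - s| ≤ 15 * (1 / (N : ℝ)) → |x - node N b| ≤ 30 * (1 / (N : ℝ)) :=
    fun x hx => by
    rw [abs_le] at hx ⊢
    constructor <;> linarith
  exact ⟨fun x hx' => key.1 x (hx x hx'), fun x z hx' hz' => key.2 x z (hx x hx') (hx z hz')⟩

theorem IsGridSetting.abs_sub_le_of_mem (S : IsGridSetting Φ fm fp s K N F a b) {x : ℝ}
    (hx : x ∈ Set.Icc (node N a) (node N b)) : |x - s| ≤ 2 * (1 / (N : ℝ)) := by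
  have hb := S.node_right_le
  rw [abs_le]
  constructor <;> linarith [hx.1, hx.2, S.mem.1, S.mem.2]

/-- At the singularity the two cubics nearly coincide. -/
theorem IsGridSetting.abs_cubics_sub_le (S : IsGridSetting Φ fm fp s K N F a b) :
    |(rightCubic N F b).eval s - (leftCubic N F a).eval s| ≤
      70000000000 * K * (1 / (N : ℝ)) ^ 4 := by
  have hh := S.step_pos
  obtain ⟨qm, Mm⟩ := S.model.left s S.model.mem_left
  obtain ⟨qp, Mp⟩ := S.model.right s S.model.mem_right
  have hs : |s - s| ≤ 15 * (1 / (N : ℝ)) := by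
    rw [sub_self, abs_zero]
    positivity
  have h1 := (S.leftCubic_near Mm hs).1 s hs
  have h2 := (S.rightCubic_near Mp hs).1 s hs
  rw [Mm.eval_self, abs_le] at h1
  rw [Mp.eval_self, abs_le] at h2
  rw [abs_le]
  constructor <;> linarith

/-- On `[x_a, x_b]` the difference of the two cubics has nearly constant slope, the jump. -/
theorem IsGridSetting.abs_cubics_sub_sub_le (S : IsGridSetting Φ fm fp s K N F a b)
    (hJ : 1000000000000 * K * (1 / (N : ℝ)) ≤ |fp s - fm s|) {x z : ℝ}
    (hx : x ∈ Set.Icc (node N a) (node N b)) (hz : z ∈ Set.Icc (node N a) (node N b)) :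
    |((rightCubic N F b).eval x - (leftCubic N F a).eval x) -
      ((rightCubic N F b).eval z - (leftCubic N F a).eval z) - (fp s - fm s) * (x - z)| ≤
      |fp s - fm s| / 2 * |x - z| := by
  have hh := S.step_pos
  have hK := S.model.nonneg
  obtain ⟨qm, Mm⟩ := S.model.left s S.model.mem_left
  obtain ⟨qp, Mp⟩ := S.model.right s S.model.mem_right
  have hs : |s - s| ≤ 15 * (1 / (N : ℝ)) := by
    rw [sub_self, abs_zero]
    positivity
  have hxs := S.abs_sub_le_of_mem hx
  have hzs := S.abs_sub_le_of_mem hz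
  have h1 := (S.leftCubic_near Mm hs).2 x z (by linarith) (by linarith)
  have h2 := (S.rightCubic_near Mp hs).2 x z (by linarith) (by linarith)
  have hb := S.node_right_le
  have hxz : |x - z| ≤ 2 * (1 / (N : ℝ)) := by
    rw [abs_le]
    constructor <;> linarith [hx.1, hx.2, hz.1, hz.2]
  have hx2 : |x| ≤ 2 := by
    have := abs_le.mp hxs
    rw [abs_le]
    constructor <;> linarith [S.margin_left, S.margin_right]
  have hz2 : |z| ≤ 2 := by
    have := abs_le.mp hzs
    rw [abs_le]
    constructor <;> linarith [S.margin_left, S.margin_right]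
  have hs2 : |s| ≤ 2 := by
    rw [abs_le]
    constructor <;> linarith [S.model.pos, S.model.lt_one]
  have lin : ∀ (q : ℝ[X]) (g : ℝ → ℝ) (I : Set ℝ), IsTaylorModel Φ g I K s q →
      |q.eval x - q.eval z - g s * (x - z)| ≤ 4 * K * (1 / (N : ℝ)) * |x - z| := by
    intro q g I M
    have l1 := abs_eval_sub_linear_le hK M.lipschitz_derivative hx2 hz2
    have l2 := M.lipschitz_derivative z s hz2 hs2
    rw [M.eval_derivative_self] at l2
    have l1' : K * |x - z| ^ 2 ≤ K * (2 * (1 / (N : ℝ))) * |x - z| := by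
      rw [sq, ← mul_assoc]
      gcongr
    have l2' : |(q.derivative.eval z - g s) * (x - z)| ≤ K * (2 * (1 / (N : ℝ))) * |x - z| := by
      rw [abs_mul]
      gcongr
      exact l2.trans (by gcongr)
    have l1'' := l1.trans l1'
    rw [abs_le] at l1'' l2' ⊢
    constructor <;> linarith
  have h3 := lin qm fm _ Mm
  have h4 := lin qp fp _ Mp
  have hle1 : 1 / (N : ℝ) ≤ 1 := by linarith [S.margin_right, S.model.pos]
  have hcube : (1 / (N : ℝ)) ^ 3 ≤ 1 / (N : ℝ) := pow_le_of_le_one hh.le hle1 (by norm_num)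
  have h5 : 35000000000 * K * (1 / (N : ℝ)) ^ 3 * |x - z| ≤
      35000000000 * K * (1 / (N : ℝ)) * |x - z| := by gcongr
  have h6 : 100000000000 * K * (1 / (N : ℝ)) * |x - z| ≤ |fp s - fm s| / 2 * |x - z| := by
    gcongr
    have : 0 ≤ K * (1 / (N : ℝ)) := by positivity
    linarith
  have h7 : 0 ≤ K * (1 / (N : ℝ)) * |x - z| := by positivity
  rw [abs_le] at h1 h2 h3 h4 ⊢
  constructor <;> linarith

theorem IsGridSetting.le_abs_cubics_sub (S : IsGridSetting Φ fm fp s K N F a b)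
    (hJ : 1000000000000 * K * (1 / (N : ℝ)) ≤ |fp s - fm s|) {x z : ℝ}
    (hx : x ∈ Set.Icc (node N a) (node N b)) (hz : z ∈ Set.Icc (node N a) (node N b)) :
    |fp s - fm s| / 2 * |x - z| ≤ |((rightCubic N F b).eval x - (leftCubic N F a).eval x) -
      ((rightCubic N F b).eval z - (leftCubic N F a).eval z)| := by
  have h := S.abs_cubics_sub_sub_le hJ hx hz
  have h2 := abs_sub_abs_le_abs_sub ((fp s - fm s) * (x - z))
    (((rightCubic N F b).eval x - (leftCubic N F a).eval x) -
      ((rightCubic N F b).eval z - (leftCubic N F a).eval z))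
  rw [abs_mul] at h2
  rw [abs_sub_comm] at h
  linarith

theorem IsGridSetting.abs_sub_located_le (S : IsGridSetting Φ fm fp s K N F a b)
    (hJ0 : fm s ≠ fp s) (hJ : 1000000000000 * K * (1 / (N : ℝ)) ≤ |fp s - fm s|) {xs : ℝ}
    (hxs : IsLocated N F a b xs) :
    |s - xs| ≤ 140000000000 * K / |fp s - fm s| * (1 / (N : ℝ)) ^ 4 := by
  have hJ1 : 0 < |fp s - fm s| := abs_pos.mpr (sub_ne_zero.mpr hJ0.symm)
  have h := S.le_abs_cubics_sub hJ S.mem hxs.1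
  rw [hxs.2, sub_self, sub_zero] at h
  have h2 := h.trans S.abs_cubics_sub_le
  rw [div_mul_eq_mul_div, le_div_iff₀ hJ1]
  linarith

/-- If `s` is well inside `[x_a, x_b]`, there is exactly one intersection point. -/
theorem IsGridSetting.existsUnique_isLocated (S : IsGridSetting Φ fm fp s K N F a b)
    (hJ0 : fm s ≠ fp s) (hJ : 1000000000000 * K * (1 / (N : ℝ)) ≤ |fp s - fm s|)
    (ha : node N a + 1 / (N : ℝ) / 4 ≤ s) (hb : s + 1 / (N : ℝ) / 4 ≤ node N b) :
    ∃! xs, IsLocated N F a b xs := by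
  have hJ1 : 0 < |fp s - fm s| := abs_pos.mpr (sub_ne_zero.mpr hJ0.symm)
  have hh := S.step_pos
  have hK := S.model.nonneg
  have hab : node N a ≤ node N b := S.mem.1.trans S.mem.2
  set D : ℝ → ℝ := fun x => (rightCubic N F b).eval x - (leftCubic N F a).eval x with hD
  set J := fp s - fm s with hJdef
  have hDs : |J * D s| ≤ |J| * (|J| * (1 / (N : ℝ)) / 10) := by
    rw [abs_mul]
    gcongr
    refine S.abs_cubics_sub_le.trans ?_
    have hle1 : 1 / (N : ℝ) ≤ 1 := by linarith [S.margin_right, S.model.pos]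
    have hp : (1 / (N : ℝ)) ^ 4 ≤ (1 / (N : ℝ)) ^ 2 :=
      pow_le_pow_of_le_one hh.le hle1 (by norm_num)
    calc _ ≤ 70000000000 * K * (1 / (N : ℝ)) ^ 2 := by gcongr
      _ ≤ 100000000000 * K * (1 / (N : ℝ)) ^ 2 := by gcongr; norm_num
      _ = 1000000000000 * K * (1 / (N : ℝ)) * (1 / (N : ℝ)) / 10 := by ring
      _ ≤ _ := by gcongr
  have hslope : ∀ x ∈ Set.Icc (node N a) (node N b),
      |J * D x - J * D s - J ^ 2 * (x - s)| ≤ J ^ 2 / 2 * |x - s| := by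
    intro x hx
    have h := S.abs_cubics_sub_sub_le hJ hx S.mem
    have e : J * D x - J * D s - J ^ 2 * (x - s) = J * (D x - D s - J * (x - s)) := by ring
    rw [e, abs_mul]
    calc _ ≤ |J| * (|J| / 2 * |x - s|) := by gcongr
      _ = |J| ^ 2 / 2 * |x - s| := by ring
      _ = _ := by rw [sq_abs]
  have e2 : |J| * (|J| * (1 / (N : ℝ)) / 10) = J ^ 2 * (1 / (N : ℝ)) / 10 := by
    rw [← sq_abs J]
    ring
  have hJ2 : 0 < J ^ 2 := by
    rw [← sq_abs]
    positivity
  rw [e2, abs_le] at hDs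
  have hright : 0 ≤ J * D (node N b) := by
    have h := hslope _ ⟨hab, le_rfl⟩
    rw [abs_of_nonneg (by linarith : 0 ≤ node N b - s), abs_le] at h
    have : J ^ 2 * (1 / (N : ℝ) / 4) ≤ J ^ 2 * (node N b - s) := by
      gcongr
      linarith
    nlinarith
  have hleft : J * D (node N a) ≤ 0 := by
    have h := hslope _ ⟨le_rfl, hab⟩
    rw [abs_of_nonpos (by linarith : node N a - s ≤ 0), abs_le] at h
    have : J ^ 2 * (1 / (N : ℝ) / 4) ≤ J ^ 2 * (s - node N a) := by
      gcongr
      linarith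
    nlinarith
  have hcont : Continuous fun x => J * D x := by fun_prop
  obtain ⟨xs, hxs, hzero⟩ := intermediate_value_Icc hab hcont.continuousOn ⟨hleft, hright⟩
  have hDx : D xs = 0 := by
    have hJne : J ≠ 0 := abs_pos.mp hJ1
    simpa [hJne] using hzero
  refine ⟨xs, ⟨hxs, (sub_eq_zero.mp hDx).symm⟩, fun z hz => ?_⟩
  have h := S.le_abs_cubics_sub hJ hz.1 hxs
  change |J| / 2 * |z - xs| ≤ |D z - D xs| at h
  have hDz : D z = 0 := sub_eq_zero.mpr hz.2.symm
  rw [hDx, hDz, sub_zero, abs_zero] at h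
  have : |z - xs| ≤ 0 := by
    by_contra hc
    push Not at hc
    have : 0 < |J| / 2 * |z - xs| := by positivity
    linarith
  exact sub_eq_zero.mp (abs_eq_zero.mp (le_antisymm this (abs_nonneg _)))

theorem exists_isMaxSecondDiff {N : ℕ} (hN : 2 ≤ N) (F : ℤ → ℝ) : ∃ k, IsMaxSecondDiff N F k := by
  obtain ⟨k, hk, hmax⟩ := Finset.exists_max_image (Finset.Icc (1 : ℤ) (N - 1))
    (fun i => |secondDiff F i|) ⟨1, by rw [Finset.mem_Icc]; omega⟩
  rw [Finset.mem_Icc] at hk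
  exact ⟨k, ⟨hk.1, by omega⟩, fun i hi hi' => hmax i (Finset.mem_Icc.mpr ⟨hi, by omega⟩)⟩

/-- The largest second difference occurs close to the singularity. -/
theorem HasJumpModel.abs_sub_le_of_isMaxSecondDiff (hM : HasJumpModel Φ fm fp s K) {N : ℕ}
    (hN : 0 < N) {F : ℤ → ℝ}
    (hF : ∀ j, node N j ∈ Set.Icc (0 : ℝ) 1 → F j = Φ (node N j)) (hJ0 : fm s ≠ fp s)
    (hJ : 1000000000000 * K * (1 / (N : ℝ)) ≤ |fp s - fm s|)
    (hl : 10 * (1 / (N : ℝ)) ≤ s) (hr : s + 10 * (1 / (N : ℝ)) ≤ 1) {k : ℤ}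
    (hk : IsMaxSecondDiff N F k) : |node N k - s| ≤ 3 / 4 * (1 / (N : ℝ)) := by
  have hJ1 : 0 < |fp s - fm s| := abs_pos.mpr (sub_ne_zero.mpr hJ0.symm)
  have hN' : (0 : ℝ) < N := by positivity
  have hh : 0 < 1 / (N : ℝ) := by positivity
  have hK := hM.nonneg
  have hnN : node N N = 1 := by simp [node, hN'.ne']
  have hn0 : node N 0 = 0 := by simp [node]
  have hrange : ∀ i : ℤ, 1 ≤ i → i + 1 ≤ N → 0 ≤ node N (i - 1) ∧ node N (i + 1) ≤ 1 := by
    intro i hi hi'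
    constructor
    · rw [← hn0]
      exact node_mono N (by omega)
    · rw [← hnN]
      exact node_mono N hi'
  set r : ℤ := round (s * N) with hrdef
  have hround := abs_sub_round (s * N)
  rw [← hrdef, abs_le] at hround
  have hsN : s * N * (1 / (N : ℝ)) = s := by field_simp
  have hrs : |node N r - s| ≤ 1 / (N : ℝ) / 2 := by
    rw [node_eq_mul, abs_le]
    constructor <;> nlinarith
  have hl' : 10 ≤ s * N := by
    have := mul_le_mul_of_nonneg_right hl hN'.le
    rwa [mul_assoc, one_div_mul_cancel hN'.ne', mul_one] at this
  have hr' : s * N + 10 ≤ N := by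
    have := mul_le_mul_of_nonneg_right hr hN'.le
    rwa [add_mul, mul_assoc 10, one_div_mul_cancel hN'.ne', mul_one, one_mul] at this
  have hr1 : 1 ≤ r := by
    have : (1 : ℝ) ≤ r := by linarith
    exact_mod_cast this
  have hr2 : r + 1 ≤ N := by
    have : (r : ℝ) + 1 ≤ N := by linarith
    exact_mod_cast this
  have hlow := hM.abs_secondDiff_sub_le hF (hrange r hr1 hr2).1 (hrange r hr1 hr2).2
    (by linarith)
  have hmax := hk.2 r hr1 hr2
  have hgrow : |fp s - fm s| * (1 / (N : ℝ) / 2) ≤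
      |(fp s - fm s) * (1 / (N : ℝ) - |node N r - s|)| := by
    rw [abs_mul]
    gcongr
    rw [abs_of_nonneg (by linarith)]
    linarith
  have hlow2 : |fp s - fm s| * (1 / (N : ℝ) / 2) - 20 * K * (1 / (N : ℝ)) ^ 2 ≤
      |secondDiff F k| := by
    have := abs_sub_abs_le_abs_sub ((fp s - fm s) * (1 / (N : ℝ) - |node N r - s|))
      (secondDiff F r)
    rw [abs_sub_comm] at hlow
    linarith
  have hsmall : 1000 * K * (1 / (N : ℝ)) ^ 2 ≤ |fp s - fm s| * (1 / (N : ℝ)) := by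
    calc _ ≤ 1000000000000 * K * (1 / (N : ℝ)) ^ 2 := by gcongr; norm_num
      _ = 1000000000000 * K * (1 / (N : ℝ)) * (1 / (N : ℝ)) := by ring
      _ ≤ _ := by gcongr
  have hJh : 0 < |fp s - fm s| * (1 / (N : ℝ)) := by positivity
  have hkr := hrange k hk.1.1 hk.1.2
  have hKh : 0 ≤ K * (1 / (N : ℝ)) ^ 2 := by positivity
  rcases le_total (1 / (N : ℝ)) |node N k - s| with hc | hc
  · have := hM.abs_secondDiff_le hF hkr.1 hkr.2 hc
    linarith
  · have h1 := hM.abs_secondDiff_sub_le hF hkr.1 hkr.2 hc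
    have h2 := abs_sub_abs_le_abs_sub (secondDiff F k)
      ((fp s - fm s) * (1 / (N : ℝ) - |node N k - s|))
    rw [abs_mul, abs_of_nonneg (sub_nonneg.mpr hc)] at h2
    by_contra hcon
    push Not at hcon
    have : |fp s - fm s| * (1 / (N : ℝ) - |node N k - s|) ≤
        |fp s - fm s| * (1 / (N : ℝ) / 4) := by
      gcongr
      linarith
    linarith

end

section

variable {Φ fm fp : ℝ → ℝ} {s K : ℝ} {N : ℕ} {F : ℤ → ℝ} {a b : ℤ}

/-- The remainder bound of a one-sided Taylor model persists slightly beyond the singularity. -/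
theorem HasJumpModel.abs_sub_eval_le (hM : HasJumpModel Φ fm fp s K) {g : ℝ → ℝ} {I : Set ℝ}
    {y : ℝ} {q : ℝ[X]} (M : IsTaylorModel Φ g I K y q) (hs : s ∈ I) {z h η : ℝ} (hη : 0 ≤ η)
    (hz : z ∈ Set.Icc (0 : ℝ) 1) (hzy : |z - y| ≤ 30 * h)
    (hzI : z ∈ I ∨ |z - s| ≤ η ∧ |s - y| ≤ 30 * h) :
    |Φ z - q.eval z| ≤ 810000 * K * h ^ 4 + 3 * K * η := by
  have hK := hM.nonneg
  have hpow : ∀ w, |w - y| ≤ 30 * h → K * |w - y| ^ 4 ≤ 810000 * K * h ^ 4 := fun w hw => by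
    calc _ ≤ K * (30 * h) ^ 4 := by gcongr
      _ = _ := by ring
  have hKη : 0 ≤ K * η := by positivity
  rcases hzI with hzI | ⟨hzs, hsy⟩
  · have := (M.abs_sub_le z hzI).trans (hpow z hzy)
    linarith
  · have h1 := (M.abs_sub_le s hs).trans (hpow s hsy)
    have h2 := hM.abs_sub_singular_le hz
    have h3 := M.lipschitz z s (abs_le.mpr ⟨by linarith [hz.1], by linarith [hz.2]⟩)
      (abs_le.mpr ⟨by linarith [hM.pos], by linarith [hM.lt_one]⟩)
    have h4 : K * |z - s| ≤ K * η := by gcongr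
    rw [abs_le] at h1 h2 h3 ⊢
    constructor <;> linarith

theorem node_natCast {N : ℕ} (hN : 0 < N) : node N N = 1 := by
  have : (N : ℝ) ≠ 0 := by positivity
  simp [node, this]

theorem node_zero (N : ℕ) : node N 0 = 0 := by simp [node]

/-- To the left of the located point, smoothed data plus the initial cubic are close to any left
Taylor model. -/
theorem IsGridSetting.abs_smoothedData_left (S : IsGridSetting Φ fm fp s K N F a b) {xs C₀ : ℝ}
    (hxs : xs ∈ Set.Icc (node N a) (node N b)) (hC₀ : 0 ≤ C₀)
    (hd : |s - xs| ≤ C₀ * (1 / (N : ℝ)) ^ 4) {x y : ℝ} {q : ℝ[X]} (hy : y ∈ Set.Icc 0 s)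
    (M : IsTaylorModel Φ fm (Set.Icc 0 s) K y q) (hx : x ≤ xs) (hxy : |x - y| ≤ 1 / (N : ℝ))
    {i : ℤ} (hi : |node N i - x| ≤ 4 * (1 / (N : ℝ))) :
    |smoothedData N F a b xs i - (q - cubic N F 0).eval (node N i)| ≤
      (80000000000 + 6 * C₀) * K * (1 / (N : ℝ)) ^ 4 := by
  have hh := S.step_pos
  have hK := S.model.nonneg
  have hb := S.node_right_le
  have hm1 := S.mem.1
  have hm2 := S.mem.2
  have hl := S.margin_left
  have hr := S.margin_right
  have hx1 := hxs.1
  have hx2 := hxs.2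
  have hη : 0 ≤ C₀ * (1 / (N : ℝ)) ^ 4 := by positivity
  have hKh : 0 ≤ K * (1 / (N : ℝ)) ^ 4 := by positivity
  have hKC : 0 ≤ C₀ * (K * (1 / (N : ℝ)) ^ 4) := by positivity
  have hxy' := abs_le.mp hxy
  have hi' := abs_le.mp hi
  have hd' := abs_le.mp hd
  have hy1 := hy.1
  have hy2 := hy.2
  have hiy : |node N i - y| ≤ 30 * (1 / (N : ℝ)) := abs_le.mpr ⟨by linarith, by linarith⟩
  rcases lt_or_ge (node N i) 0 with hneg | hnn
  · have hsm : smoothedData N F a b xs i = 0 := by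
      rw [smoothedData, totalCorrection, jumpCorrection, S.data_of_neg i hneg,
        if_neg (by linarith), if_neg (by linarith), if_neg (by linarith)]
      ring
    have key := (M.abs_eval_cubic_sub_le S.pos hK (F := F) (m := 0)
      (fun j hj => S.data j (S.model.Icc_left_subset hj)) (by rw [node_zero])
      (by rw [node_zero]; linarith)
      (by rw [node_zero, abs_le]; constructor <;> linarith)).1 (node N i)
      (by rw [node_zero, abs_le]; constructor <;> linarith)
    rw [hsm, eval_sub, zero_sub, neg_sub]
    linarith
  · have hle : node N i ≤ 1 := by linarith
    have h01 : node N i ∈ Set.Icc (0 : ℝ) 1 := ⟨hnn, hle⟩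
    rcases lt_or_ge (node N i) xs with hlt | hge
    · have hsm : smoothedData N F a b xs i = F i - (cubic N F 0).eval (node N i) := by
        rw [smoothedData, totalCorrection_of_mem_Icc _ _ _ _ _ h01, jumpCorrection,
          if_neg (by linarith), add_zero]
      have key := S.model.abs_sub_eval_le M S.model.mem_left hη h01 hiy (by
        rcases le_total (node N i) s with h | h
        · exact Or.inl ⟨hnn, h⟩
        · exact Or.inr ⟨abs_le.mpr ⟨by linarith, by linarith⟩,
            abs_le.mpr ⟨by linarith, by linarith⟩⟩)
      rw [hsm, eval_sub, sub_sub_sub_cancel_right, S.data i h01]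
      linarith
    · have hsm : smoothedData N F a b xs i = F i - (cubic N F 0).eval (node N i) -
          ((rightCubic N F b).eval (node N i) - (leftCubic N F a).eval (node N i)) := by
        rw [smoothedData, totalCorrection_of_mem_Icc _ _ _ _ _ h01, jumpCorrection, if_pos hge]
        ring
      obtain ⟨qp, Mp⟩ := S.model.right s S.model.mem_right
      have his : |node N i - s| ≤ 15 * (1 / (N : ℝ)) := abs_le.mpr ⟨by linarith, by linarith⟩
      have hss : |s - s| ≤ 15 * (1 / (N : ℝ)) := by
        rw [sub_self, abs_zero]
        positivity
      have k1 := S.model.abs_sub_eval_le Mp S.model.mem_right hη h01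
        (h := 1 / (N : ℝ)) (by linarith) (by
        rcases le_total s (node N i) with h | h
        · exact Or.inl ⟨h, hle⟩
        · exact Or.inr ⟨abs_le.mpr ⟨by linarith, by linarith⟩, by linarith⟩)
      have k2 := (S.rightCubic_near Mp hss).1 _ his
      have k3 := (S.leftCubic_near M (abs_le.mpr ⟨by linarith, by linarith⟩)).1 _ his
      rw [hsm, eval_sub, S.data i h01]
      rw [abs_le] at k1 k2 k3 ⊢
      constructor <;> linarith

/-- To the right of the located point, smoothed data plus the initial cubic and the jump
correction are close to any right Taylor model. -/
theorem IsGridSetting.abs_smoothedData_right (S : IsGridSetting Φ fm fp s K N F a b) {xs C₀ : ℝ}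
    (hxs : xs ∈ Set.Icc (node N a) (node N b)) (hC₀ : 0 ≤ C₀)
    (hd : |s - xs| ≤ C₀ * (1 / (N : ℝ)) ^ 4) {x y : ℝ} {q : ℝ[X]} (hy : y ∈ Set.Icc s 1)
    (M : IsTaylorModel Φ fp (Set.Icc s 1) K y q) (hx : xs ≤ x) (hxy : |x - y| ≤ 1 / (N : ℝ))
    {i : ℤ} (hi : |node N i - x| ≤ 4 * (1 / (N : ℝ))) :
    |smoothedData N F a b xs i -
        (q - (cubic N F 0 + (rightCubic N F b - leftCubic N F a))).eval (node N i)| ≤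
      (80000000000 + 6 * C₀) * K * (1 / (N : ℝ)) ^ 4 := by
  have hh := S.step_pos
  have hK := S.model.nonneg
  have hb := S.node_right_le
  have hm1 := S.mem.1
  have hm2 := S.mem.2
  have hl := S.margin_left
  have hr := S.margin_right
  have hx1 := hxs.1
  have hx2 := hxs.2
  have hη : 0 ≤ C₀ * (1 / (N : ℝ)) ^ 4 := by positivity
  have hKh : 0 ≤ K * (1 / (N : ℝ)) ^ 4 := by positivity
  have hKC : 0 ≤ C₀ * (K * (1 / (N : ℝ)) ^ 4) := by positivity
  have hxy' := abs_le.mp hxy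
  have hi' := abs_le.mp hi
  have hd' := abs_le.mp hd
  have hy1 := hy.1
  have hy2 := hy.2
  have hiy : |node N i - y| ≤ 30 * (1 / (N : ℝ)) := abs_le.mpr ⟨by linarith, by linarith⟩
  have hnn : 0 ≤ node N i := by linarith
  simp only [eval_sub, eval_add]
  rcases lt_or_ge 1 (node N i) with hgt | hle
  · have hsm : smoothedData N F a b xs i = (cubic N F (N - 3)).eval (node N i) -
        ((cubic N F 0).eval (node N i) +
          ((rightCubic N F b).eval (node N i) - (leftCubic N F a).eval (node N i))) := by
      rw [smoothedData, totalCorrection, jumpCorrection, S.data_of_one_lt i hgt,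
        if_pos hnn, if_pos (by linarith), if_pos hgt]
      ring
    have hn3 : node N ((N : ℤ) - 3) = 1 - 3 * (1 / (N : ℝ)) := by
      rw [node_sub_three, node_natCast S.pos]
    have key := (M.abs_eval_cubic_sub_le S.pos hK (F := F) (m := (N : ℤ) - 3)
      (fun j hj => S.data j (S.model.Icc_right_subset hj)) (by rw [hn3]; linarith)
      (by rw [hn3]; linarith)
      (by rw [hn3, abs_le]; constructor <;> linarith)).1 (node N i)
      (by rw [hn3, abs_le]; constructor <;> linarith)
    rw [hsm, sub_sub_sub_cancel_right]
    linarith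
  · have h01 : node N i ∈ Set.Icc (0 : ℝ) 1 := ⟨hnn, hle⟩
    rcases lt_or_ge (node N i) xs with hlt | hge
    · have hsm : smoothedData N F a b xs i = F i - (cubic N F 0).eval (node N i) := by
        rw [smoothedData, totalCorrection_of_mem_Icc _ _ _ _ _ h01, jumpCorrection,
          if_neg (by linarith), add_zero]
      obtain ⟨qm, Mm⟩ := S.model.left s S.model.mem_left
      have his : |node N i - s| ≤ 15 * (1 / (N : ℝ)) := abs_le.mpr ⟨by linarith, by linarith⟩
      have hss : |s - s| ≤ 15 * (1 / (N : ℝ)) := by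
        rw [sub_self, abs_zero]
        positivity
      have k1 := S.model.abs_sub_eval_le Mm S.model.mem_left hη h01
        (h := 1 / (N : ℝ)) (by linarith) (by
        rcases le_total (node N i) s with h | h
        · exact Or.inl ⟨hnn, h⟩
        · exact Or.inr ⟨abs_le.mpr ⟨by linarith, by linarith⟩, by linarith⟩)
      have k2 := (S.leftCubic_near Mm hss).1 _ his
      have k3 := (S.rightCubic_near M (abs_le.mpr ⟨by linarith, by linarith⟩)).1 _ his
      rw [hsm, S.data i h01]
      rw [abs_le] at k1 k2 k3 ⊢
      constructor <;> linarith
    · have hsm : smoothedData N F a b xs i = F i - ((cubic N F 0).eval (node N i) +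
          ((rightCubic N F b).eval (node N i) - (leftCubic N F a).eval (node N i))) := by
        rw [smoothedData, totalCorrection_of_mem_Icc _ _ _ _ _ h01, jumpCorrection, if_pos hge]
      have key := S.model.abs_sub_eval_le M S.model.mem_right hη h01 hiy (by
        rcases le_total s (node N i) with h | h
        · exact Or.inl ⟨h, hle⟩
        · exact Or.inr ⟨abs_le.mpr ⟨by linarith, by linarith⟩,
            abs_le.mpr ⟨by linarith, by linarith⟩⟩)
      rw [hsm, sub_sub_sub_cancel_right, S.data i h01]
      linarith

/-- Off `xs`, `G` is differentiable, being locally a differentiable limit function plus a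
polynomial. -/
theorem IsRCApproximation.exists_limit (hN : 0 < N) {xs : ℝ} {G : ℝ → ℝ}
    (hG : IsRCApproximation N F a b xs G) :
    ∃ u, IsSubdivisionLimit N (smoothedData N F a b xs) u ∧ Differentiable ℝ u ∧
      (∀ x, G x = u x + ((cubic N F 0).eval x + jumpCorrection N F a b xs x)) ∧
      (∀ x < xs, HasDerivAt G (deriv u x + (cubic N F 0).derivative.eval x) x) ∧
      ∀ x, xs < x → HasDerivAt G (deriv u x +
        (cubic N F 0 + (rightCubic N F b - leftCubic N F a)).derivative.eval x) x := by
  obtain ⟨u, hu, hGu⟩ := hG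
  have hud := hu.differentiable hN
  refine ⟨u, hu, hud, hGu, fun x hx => ?_, fun x hx => ?_⟩
  · refine ((hud x).hasDerivAt.add ((cubic N F 0).hasDerivAt x)).congr_of_eventuallyEq ?_
    filter_upwards [eventually_lt_nhds hx] with z hz
    rw [hGu, jumpCorrection, if_neg (not_le.mpr hz), add_zero, Pi.add_apply]
  · refine ((hud x).hasDerivAt.add
      ((cubic N F 0 + (rightCubic N F b - leftCubic N F a)).hasDerivAt x)).congr_of_eventuallyEq ?_
    filter_upwards [eventually_gt_nhds hx] with z hz
    rw [hGu, jumpCorrection, if_pos hz.le, Pi.add_apply, eval_add, eval_sub]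

theorem existsUnique_isRCApproximation (hN : 0 < N) (F : ℤ → ℝ) (a b : ℤ) (xs : ℝ) :
    ∃! G, IsRCApproximation N F a b xs G := by
  obtain ⟨u, _, hu⟩ := exists_isSubdivisionLimit hN (smoothedData N F a b xs)
  refine ⟨_, ⟨u, hu, fun x => rfl⟩, ?_⟩
  rintro G ⟨v, hv, hG⟩
  funext x
  rw [hG, hv.unique hN hu]

theorem IsRCApproximation.eval_node (hN : 0 < N) {xs : ℝ} {G : ℝ → ℝ}
    (hG : IsRCApproximation N F a b xs G) {j : ℤ} (hj : 0 ≤ j) (hj' : j ≤ N) :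
    G (node N j) = F j := by
  obtain ⟨u, hu, hGu⟩ := hG
  have h := hu.2 0 j
  have h01 : node N j ∈ Set.Icc (0 : ℝ) 1 := by
    rw [← node_zero N, ← node_natCast hN]
    exact ⟨node_mono N hj, node_mono N hj'⟩
  simp only [pow_zero, div_one, Function.iterate_zero, id] at h
  rw [hGu, h, smoothedData, totalCorrection_of_mem_Icc _ _ _ _ _ h01]
  ring

theorem abs_node_sub_le_of_abs_sub_le (hN : 0 < N) {i : ℤ} {x : ℝ} (h : |(i : ℝ) - x * N| ≤ 4) :
    |node N i - x| ≤ 4 * (1 / (N : ℝ)) := by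
  have hN' : (0 : ℝ) < N := by positivity
  have e : node N i - x = (i - x * N) * (1 / (N : ℝ)) := by
    rw [node]
    field_simp
  rw [e, abs_mul, abs_of_pos (by positivity : 0 < 1 / (N : ℝ))]
  gcongr

/-- The limit function and its derivative to the left of the located point. -/
theorem IsGridSetting.abs_limit_left (S : IsGridSetting Φ fm fp s K N F a b) {xs C₀ : ℝ}
    (hxs : xs ∈ Set.Icc (node N a) (node N b)) (hC₀ : 0 ≤ C₀)
    (hd : |s - xs| ≤ C₀ * (1 / (N : ℝ)) ^ 4) {u : ℝ → ℝ}
    (hu : IsSubdivisionLimit N (smoothedData N F a b xs) u) {x y : ℝ} {q : ℝ[X]}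
    (hy : y ∈ Set.Icc 0 s) (M : IsTaylorModel Φ fm (Set.Icc 0 s) K y q) (hx : x ≤ xs)
    (hxy : |x - y| ≤ 1 / (N : ℝ)) :
    |u x + (cubic N F 0).eval x - q.eval x| ≤
        35 * ((80000000000 + 6 * C₀) * K) * (1 / (N : ℝ)) ^ 4 ∧
      |deriv u x + (cubic N F 0).derivative.eval x - q.derivative.eval x| ≤
        34 * ((80000000000 + 6 * C₀) * K) * (1 / (N : ℝ)) ^ 3 := by
  have hK := S.model.nonneg
  have hN' : (N : ℝ) ≠ 0 := by
    have := S.pos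
    positivity
  have h := hu.abs_sub_le S.pos (q := q - cubic N F 0) (x := x)
    (ε := (80000000000 + 6 * C₀) * K * (1 / (N : ℝ)) ^ 4)
    ((degree_sub_le _ _).trans_lt (max_lt M.degree_lt (degree_cubic_lt S.pos F 0)))
    (by positivity) (fun i hi => S.abs_smoothedData_left hxs hC₀ hd hy M hx hxy
      (abs_node_sub_le_of_abs_sub_le S.pos hi))
  rw [eval_sub, derivative_sub, eval_sub] at h
  refine ⟨?_, ?_⟩
  · have e : u x + (cubic N F 0).eval x - q.eval x =
        u x - (q.eval x - (cubic N F 0).eval x) := by ring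
    rw [e]
    exact h.1.trans (le_of_eq (by ring))
  · have e : deriv u x + (cubic N F 0).derivative.eval x - q.derivative.eval x =
        deriv u x - (q.derivative.eval x - (cubic N F 0).derivative.eval x) := by ring
    rw [e]
    refine h.2.trans (le_of_eq ?_)
    field_simp

/-- The limit function and its derivative to the right of the located point. -/
theorem IsGridSetting.abs_limit_right (S : IsGridSetting Φ fm fp s K N F a b) {xs C₀ : ℝ}
    (hxs : xs ∈ Set.Icc (node N a) (node N b)) (hC₀ : 0 ≤ C₀)
    (hd : |s - xs| ≤ C₀ * (1 / (N : ℝ)) ^ 4) {u : ℝ → ℝ}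
    (hu : IsSubdivisionLimit N (smoothedData N F a b xs) u) {x y : ℝ} {q : ℝ[X]}
    (hy : y ∈ Set.Icc s 1) (M : IsTaylorModel Φ fp (Set.Icc s 1) K y q) (hx : xs ≤ x)
    (hxy : |x - y| ≤ 1 / (N : ℝ)) :
    |u x + (cubic N F 0 + (rightCubic N F b - leftCubic N F a)).eval x - q.eval x| ≤
        35 * ((80000000000 + 6 * C₀) * K) * (1 / (N : ℝ)) ^ 4 ∧
      |deriv u x + (cubic N F 0 + (rightCubic N F b - leftCubic N F a)).derivative.eval x -
          q.derivative.eval x| ≤ 34 * ((80000000000 + 6 * C₀) * K) * (1 / (N : ℝ)) ^ 3 := by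
  have hK := S.model.nonneg
  have hN' : (N : ℝ) ≠ 0 := by
    have := S.pos
    positivity
  set P := cubic N F 0 + (rightCubic N F b - leftCubic N F a) with hP
  have hPd : P.degree < 4 :=
    (degree_add_le _ _).trans_lt (max_lt (degree_cubic_lt S.pos F 0)
      ((degree_sub_le _ _).trans_lt (max_lt (degree_cubic_lt S.pos F _)
        (degree_cubic_lt S.pos F _))))
  have h := hu.abs_sub_le S.pos (q := q - P) (x := x)
    (ε := (80000000000 + 6 * C₀) * K * (1 / (N : ℝ)) ^ 4)
    ((degree_sub_le _ _).trans_lt (max_lt M.degree_lt hPd))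
    (by positivity) (fun i hi => S.abs_smoothedData_right hxs hC₀ hd hy M hx hxy
      (abs_node_sub_le_of_abs_sub_le S.pos hi))
  rw [eval_sub, derivative_sub, eval_sub] at h
  refine ⟨?_, ?_⟩
  · have e : u x + P.eval x - q.eval x = u x - (q.eval x - P.eval x) := by ring
    rw [e]
    exact h.1.trans (le_of_eq (by ring))
  · have e : deriv u x + P.derivative.eval x - q.derivative.eval x =
        deriv u x - (q.derivative.eval x - P.derivative.eval x) := by ring
    rw [e]
    refine h.2.trans (le_of_eq ?_)
    field_simp

end

section

variable {Φ fm fp : ℝ → ℝ} {s K : ℝ} {N : ℕ} {F : ℤ → ℝ} {a b : ℤ}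

theorem IsGridSetting.abs_deriv_left (S : IsGridSetting Φ fm fp s K N F a b) {xs C₀ : ℝ}
    (hxs : xs ∈ Set.Icc (node N a) (node N b)) (hC₀ : 0 ≤ C₀)
    (hd : |s - xs| ≤ C₀ * (1 / (N : ℝ)) ^ 4) (hd1 : |s - xs| ≤ 1 / (N : ℝ)) {G : ℝ → ℝ}
    (hG : IsRCApproximation N F a b xs G) {x y : ℝ} (hy : y ∈ Set.Icc 0 s) (hx : x < xs)
    (hxy : |x - y| ≤ |s - xs|) :
    |fm y - deriv G x| ≤ (34 * ((80000000000 + 6 * C₀) * K) + K * C₀) * (1 / (N : ℝ)) ^ 3 := by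
  have hh := S.step_pos
  have hK := S.model.nonneg
  obtain ⟨u, hu, -, -, hl, -⟩ := hG.exists_limit S.pos
  obtain ⟨q, M⟩ := S.model.left y hy
  have h1 := (S.abs_limit_left hxs hC₀ hd hu hy M hx.le (hxy.trans hd1)).2
  have hxy' := abs_le.mp (hxy.trans hd1)
  have hy1 := hy.1
  have hy2 := hy.2
  have hml := S.margin_left
  have hmr := S.margin_right
  have h2 := M.lipschitz_derivative x y (abs_le.mpr ⟨by linarith, by linarith⟩)
    (abs_le.mpr ⟨by linarith, by linarith⟩)
  rw [M.eval_derivative_self] at h2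
  have h3 : K * |x - y| ≤ K * C₀ * (1 / (N : ℝ)) ^ 3 := by
    rw [mul_assoc]
    have hp : (1 / (N : ℝ)) ^ 4 ≤ (1 / (N : ℝ)) ^ 3 :=
      pow_le_pow_of_le_one hh.le (by linarith) (by norm_num)
    have : C₀ * (1 / (N : ℝ)) ^ 4 ≤ C₀ * (1 / (N : ℝ)) ^ 3 := by gcongr
    gcongr K * ?_
    linarith
  rw [(hl x hx).deriv]
  rw [abs_le] at h1 h2 ⊢
  constructor <;> linarith

theorem IsGridSetting.abs_deriv_right (S : IsGridSetting Φ fm fp s K N F a b) {xs C₀ : ℝ}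
    (hxs : xs ∈ Set.Icc (node N a) (node N b)) (hC₀ : 0 ≤ C₀)
    (hd : |s - xs| ≤ C₀ * (1 / (N : ℝ)) ^ 4) (hd1 : |s - xs| ≤ 1 / (N : ℝ)) {G : ℝ → ℝ}
    (hG : IsRCApproximation N F a b xs G) {x y : ℝ} (hy : y ∈ Set.Icc s 1) (hx : xs < x)
    (hxy : |x - y| ≤ |s - xs|) :
    |fp y - deriv G x| ≤ (34 * ((80000000000 + 6 * C₀) * K) + K * C₀) * (1 / (N : ℝ)) ^ 3 := by
  have hh := S.step_pos
  have hK := S.model.nonneg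
  obtain ⟨u, hu, -, -, -, hr⟩ := hG.exists_limit S.pos
  obtain ⟨q, M⟩ := S.model.right y hy
  have h1 := (S.abs_limit_right hxs hC₀ hd hu hy M hx.le (hxy.trans hd1)).2
  have hxy' := abs_le.mp (hxy.trans hd1)
  have hy1 := hy.1
  have hy2 := hy.2
  have hml := S.margin_left
  have hmr := S.margin_right
  have h2 := M.lipschitz_derivative x y (abs_le.mpr ⟨by linarith, by linarith⟩)
    (abs_le.mpr ⟨by linarith, by linarith⟩)
  rw [M.eval_derivative_self] at h2
  have h3 : K * |x - y| ≤ K * C₀ * (1 / (N : ℝ)) ^ 3 := by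
    rw [mul_assoc]
    have hp : (1 / (N : ℝ)) ^ 4 ≤ (1 / (N : ℝ)) ^ 3 :=
      pow_le_pow_of_le_one hh.le (by linarith) (by norm_num)
    have : C₀ * (1 / (N : ℝ)) ^ 4 ≤ C₀ * (1 / (N : ℝ)) ^ 3 := by gcongr
    gcongr K * ?_
    linarith
  rw [(hr x hx).deriv]
  rw [abs_le] at h1 h2 ⊢
  constructor <;> linarith

theorem IsGridSetting.abs_sub_approximation_le (S : IsGridSetting Φ fm fp s K N F a b)
    {xs C₀ : ℝ} (hxs : xs ∈ Set.Icc (node N a) (node N b)) (hC₀ : 0 ≤ C₀)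
    (hd : |s - xs| ≤ C₀ * (1 / (N : ℝ)) ^ 4) (hd1 : |s - xs| ≤ 1 / (N : ℝ)) {G : ℝ → ℝ}
    (hG : IsRCApproximation N F a b xs G) {x : ℝ} (hx : x ∈ Set.Icc (0 : ℝ) 1) :
    |Φ x - G x| ≤
      (35 * ((80000000000 + 6 * C₀) * K) + 3 * (K * C₀)) * (1 / (N : ℝ)) ^ 4 := by
  have hh := S.step_pos
  have hK := S.model.nonneg
  have hs0 := S.model.pos
  have hs1 := S.model.lt_one
  obtain ⟨u, hu, -, hGu, -, -⟩ := hG.exists_limit S.pos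
  have hx2 : |x| ≤ 2 := abs_le.mpr ⟨by linarith [hx.1], by linarith [hx.2]⟩
  have hs2 : |s| ≤ 2 := abs_le.mpr ⟨by linarith, by linarith⟩
  have hKC : 0 ≤ K * C₀ * (1 / (N : ℝ)) ^ 4 := by positivity
  have hfar := S.model.abs_sub_singular_le hx
  have hbetween : |x - s| ≤ |s - xs| → K * |x - s| ≤ K * C₀ * (1 / (N : ℝ)) ^ 4 := fun h => by
    rw [mul_assoc]
    gcongr
    exact h.trans hd
  rcases lt_or_ge x xs with hlt | hge
  · rw [hGu, jumpCorrection, if_neg (not_le.mpr hlt), add_zero]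
    rcases le_total x s with hxs' | hxs'
    · obtain ⟨q, M⟩ := S.model.left x ⟨hx.1, hxs'⟩
      have h1 := (S.abs_limit_left hxs hC₀ hd hu ⟨hx.1, hxs'⟩ M hlt.le
        (by rw [sub_self, abs_zero]; exact hh.le)).1
      rw [M.eval_self] at h1
      rw [abs_le] at h1 ⊢
      constructor <;> linarith
    · obtain ⟨q, M⟩ := S.model.left s S.model.mem_left
      have hsx : |x - s| ≤ |s - xs| := by
        rw [abs_of_nonneg (by linarith), abs_of_nonpos (by linarith)]
        linarith
      have h1 := (S.abs_limit_left hxs hC₀ hd hu S.model.mem_left M hlt.le (hsx.trans hd1)).1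
      have h2 := M.lipschitz x s hx2 hs2
      rw [M.eval_self] at h2
      have h3 := hbetween hsx
      rw [abs_le] at h1 h2 hfar ⊢
      constructor <;> linarith
  · have hGx : G x = u x +
        (cubic N F 0 + (rightCubic N F b - leftCubic N F a)).eval x := by
      rw [hGu, jumpCorrection, if_pos hge, eval_add, eval_sub]
    rw [hGx]
    rcases le_total s x with hxs' | hxs'
    · obtain ⟨q, M⟩ := S.model.right x ⟨hxs', hx.2⟩
      have h1 := (S.abs_limit_right hxs hC₀ hd hu ⟨hxs', hx.2⟩ M hge
        (by rw [sub_self, abs_zero]; exact hh.le)).1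
      rw [M.eval_self] at h1
      rw [abs_le] at h1 ⊢
      constructor <;> linarith
    · obtain ⟨q, M⟩ := S.model.right s S.model.mem_right
      have hsx : |x - s| ≤ |s - xs| := by
        rw [abs_of_nonpos (by linarith), abs_of_nonneg (by linarith)]
        linarith
      have h1 := (S.abs_limit_right hxs hC₀ hd hu S.model.mem_right M hge (hsx.trans hd1)).1
      have h2 := M.lipschitz x s hx2 hs2
      rw [M.eval_self] at h2
      have h3 := hbetween hsx
      rw [abs_le] at h1 h2 hfar ⊢
      constructor <;> linarith

theorem IsDetected.cells {N : ℕ} {F : ℤ → ℝ} {a b : ℤ} (h : IsDetected N F a b) :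
    b = a + 1 ∨ b = a + 2 := by
  rcases h with ⟨h, -⟩ | ⟨h, -⟩
  · exact Or.inr h
  · exact Or.inl h

/-- If second differences are maximal only close to `s`, then `s` is well inside every detected
interval. -/
theorem IsDetected.margins {N : ℕ} {F : ℤ → ℝ} {a b : ℤ} {s : ℝ} (h : IsDetected N F a b)
    (hmax : ∀ k, IsMaxSecondDiff N F k → |node N k - s| ≤ 3 / 4 * (1 / (N : ℝ))) :
    node N a + 1 / (N : ℝ) / 4 ≤ s ∧ s + 1 / (N : ℝ) / 4 ≤ node N b := by
  rcases h with ⟨rfl, h⟩ | ⟨rfl, h, h'⟩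
  · have h1 := abs_le.mp (hmax _ h)
    rw [show a + 2 = a + 1 + 1 by ring, node_add_one N (a + 1)]
    rw [node_add_one] at h1 ⊢
    constructor <;> linarith
  · have h1 := abs_le.mp (hmax _ h)
    have h2 := abs_le.mp (hmax _ h')
    rw [node_add_one] at h2 ⊢
    constructor <;> linarith

theorem exists_nat_forall_one_div_le {η : ℝ} (hη : 0 < η) :
    ∃ N₀ : ℕ, 0 < N₀ ∧ ∀ N : ℕ, N₀ ≤ N → 1 / (N : ℝ) ≤ η := by
  obtain ⟨n, hn⟩ := exists_nat_one_div_lt hη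
  refine ⟨n + 1, n.succ_pos, fun N hN => le_trans ?_ hn.le⟩
  have : ((n : ℝ) + 1) ≤ N := by exact_mod_cast hN
  gcongr

end

end RC

theorem theorem3 (f : ℝ → ℝ) (s : ℝ) (hf : RC.IsPiecewiseC3WithJump f s) :
    ∃ (C : ℝ) (N₀ : ℕ), 0 < N₀ ∧ ∀ N : ℕ, N₀ ≤ N → ∀ F : ℤ → ℝ,
      F = RC.primitiveData N (RC.cellAverage f N) →
      -- the detection step succeeds, and the singular point is then well defined
      (∃ a b : ℤ, RC.IsDetected N F a b) ∧
      (∀ a b : ℤ, RC.IsDetected N F a b →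
        s ∈ Set.Icc (RC.node N a) (RC.node N b) ∧ ∃! xs : ℝ, RC.IsLocated N F a b xs) ∧
      -- the output for any interval of one or two cells around `s` (in particular the detected one)
      (∀ a b : ℤ, (b = a + 1 ∨ b = a + 2) → s ∈ Set.Icc (RC.node N a) (RC.node N b) →
        ∀ xs : ℝ, RC.IsLocated N F a b xs →
          |s - xs| ≤ C * (1 / (N : ℝ)) ^ 4 ∧
          (∃! G : ℝ → ℝ, RC.IsRCApproximation N F a b xs G) ∧
          ∀ G : ℝ → ℝ, RC.IsRCApproximation N F a b xs G →
            (∀ j : ℤ, 0 ≤ j → j ≤ N → G (RC.node N j) = F j) ∧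
            (∀ x ∈ Set.Icc (0 : ℝ) 1,
              |(∫ y in (0 : ℝ)..x, f y) - G x| ≤ C * (1 / (N : ℝ)) ^ 4) ∧
            (∀ x : ℝ, x ≠ xs → DifferentiableAt ℝ G x) ∧
            (∀ x ∈ Set.Icc (0 : ℝ) 1, x ∉ Set.uIcc s xs →
              |f x - deriv G x| ≤ C * (1 / (N : ℝ)) ^ 3) ∧
            (∀ x ∈ Set.Icc (0 : ℝ) 1, x ≠ s →
              |f x - deriv G (x + (xs - s))| ≤ C * (1 / (N : ℝ)) ^ 3)) := by
  obtain ⟨hs, fm, fp, hfm, hfp, hm, hp, hne⟩ := hf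
  obtain ⟨hint, K, hM⟩ := RC.exists_hasJumpModel hs hfm hfp hm hp
  have hK := hM.nonneg
  have hJ : 0 < |fp s - fm s| := abs_pos.mpr (sub_ne_zero.mpr hne.symm)
  set Φ : ℝ → ℝ := fun x => ∫ y in (0 : ℝ)..x, f y with hΦ
  set C₀ : ℝ := 140000000000 * K / |fp s - fm s| with hC₀def
  have hC₀ : 0 ≤ C₀ := by positivity
  set A : ℝ := (80000000000 + 6 * C₀) * K with hA
  have hA0 : 0 ≤ A := by positivity
  have hKC : 0 ≤ K * C₀ := by positivity
  set C : ℝ := C₀ + 35 * A + 3 * (K * C₀) with hC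
  have hs0 := hs.1
  have hs1 : 0 < 1 - s := sub_pos.mpr hs.2
  obtain ⟨N₀, hN₀, hsmall⟩ := RC.exists_nat_forall_one_div_le
    (η := min (min (s / 10) ((1 - s) / 10))
      (min (|fp s - fm s| / (1000000000000 * (K + 1))) (1 / (C₀ + 1)))) (by positivity)
  refine ⟨C, N₀, hN₀, fun N hN F hF => ?_⟩
  have hNpos : 0 < N := hN₀.trans_le hN
  have hh : 0 < 1 / (N : ℝ) := by positivity
  have hη := hsmall N hN
  rw [le_min_iff, le_min_iff, le_min_iff, le_div_iff₀ (by positivity : (0 : ℝ) < C₀ + 1),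
    le_div_iff₀ (by positivity : 0 < 1000000000000 * (K + 1))] at hη
  obtain ⟨⟨hη1, hη2⟩, hη3, hη4⟩ := hη
  have hl : 10 * (1 / (N : ℝ)) ≤ s := by linarith
  have hr : s + 10 * (1 / (N : ℝ)) ≤ 1 := by linarith
  have hJK : 1000000000000 * K * (1 / (N : ℝ)) ≤ |fp s - fm s| := by nlinarith
  have hNtwo : 2 ≤ N := by
    have h1 : 1 / (N : ℝ) < 1 := by linarith
    rw [div_lt_one (by positivity)] at h1
    exact_mod_cast h1
  have hrange : ∀ j : ℤ, (0 ≤ j ∧ j ≤ N) ↔ RC.node N j ∈ Set.Icc (0 : ℝ) 1 := fun j => by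
    have hN' : (0 : ℝ) < N := by positivity
    rw [Set.mem_Icc, RC.node, le_div_iff₀ hN', zero_mul, div_le_one hN']
    norm_cast
  have hdata : ∀ j, RC.node N j ∈ Set.Icc (0 : ℝ) 1 → F j = Φ (RC.node N j) := fun j hj => by
    have h := (hrange j).mpr hj
    rw [hF, RC.primitiveData_cellAverage hNpos hint h.1 h.2]
  have hout : ∀ j, RC.node N j ∉ Set.Icc (0 : ℝ) 1 → F j = 0 := fun j hj => by
    rw [hF, RC.primitiveData, if_neg (fun h => hj ((hrange j).mp h))]
  have hS : ∀ a b : ℤ, (b = a + 1 ∨ b = a + 2) → s ∈ Set.Icc (RC.node N a) (RC.node N b) →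
      RC.IsGridSetting Φ fm fp s K N F a b := fun a b hab hsab =>
    ⟨hM, hNpos, hdata, fun j hj => hout j fun h => absurd h.1 (not_le.mpr hj),
      fun j hj => hout j fun h => absurd h.2 (not_le.mpr hj), hab, hsab, hl, hr⟩
  refine ⟨?_, fun a b hab => ?_, fun a b hab hsab xs hxs => ?_⟩
  · obtain ⟨k, hk⟩ := RC.exists_isMaxSecondDiff hNtwo F
    exact ⟨k - 1, k + 1, Or.inl ⟨by ring, by rwa [sub_add_cancel]⟩⟩
  · obtain ⟨h1, h2⟩ := hab.margins fun k hk =>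
      hM.abs_sub_le_of_isMaxSecondDiff hNpos hdata hne hJK hl hr hk
    have hmem : s ∈ Set.Icc (RC.node N a) (RC.node N b) := ⟨by linarith, by linarith⟩
    exact ⟨hmem, (hS a b hab.cells hmem).existsUnique_isLocated hne hJK h1 h2⟩
  · have S := hS a b hab hsab
    have hd := S.abs_sub_located_le hne hJK hxs
    have hd1 : |s - xs| ≤ 1 / (N : ℝ) := by
      refine hd.trans ?_
      have hp : (1 / (N : ℝ)) ^ 4 ≤ (1 / (N : ℝ)) ^ 2 :=
        pow_le_pow_of_le_one hh.le (by linarith) (by norm_num)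
      calc C₀ * (1 / (N : ℝ)) ^ 4 ≤ C₀ * (1 / (N : ℝ)) ^ 2 := by gcongr
        _ = (1 / (N : ℝ) * C₀) * (1 / (N : ℝ)) := by ring
        _ ≤ 1 * (1 / (N : ℝ)) := by
          gcongr
          linarith
        _ = 1 / (N : ℝ) := one_mul _
    have hCd : (34 * A + K * C₀) * (1 / (N : ℝ)) ^ 3 ≤ C * (1 / (N : ℝ)) ^ 3 := by
      gcongr
      linarith
    refine ⟨hd.trans (by gcongr; linarith), RC.existsUnique_isRCApproximation hNpos F a b xs,
      fun G hG => ⟨fun j hj hj' => hG.eval_node hNpos hj hj', fun x hx => ?_, fun x hx => ?_,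
        fun x hx hx' => ?_, fun x hx hx' => ?_⟩⟩
    · refine (S.abs_sub_approximation_le hxs.1 hC₀ hd hd1 hG hx).trans ?_
      gcongr
      linarith
    · obtain ⟨u, -, -, -, hleft, hright⟩ := hG.exists_limit hNpos
      rcases lt_or_gt_of_ne hx with h | h
      · exact (hleft x h).differentiableAt
      · exact (hright x h).differentiableAt
    · rw [Set.mem_uIcc, not_or, not_and_or, not_and_or, not_le, not_le, not_le, not_le] at hx'
      rcases lt_or_ge x s with h | h
      · have hlt : x < xs := by
          rcases hx'.2 with h2 | h2 <;> linarith
        rw [hm ⟨hx.1, h⟩]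
        exact (S.abs_deriv_left hxs.1 hC₀ hd hd1 hG ⟨hx.1, h.le⟩ hlt
          (by rw [sub_self, abs_zero]; exact abs_nonneg _)).trans hCd
      · have hgt : xs < x := by
          rcases hx'.1 with h2 | h2 <;> linarith
        have hne' : s ≠ x := by
          rintro rfl
          rcases hx'.2 with h2 | h2 <;> linarith
        rw [hp ⟨lt_of_le_of_ne h hne', hx.2⟩]
        exact (S.abs_deriv_right hxs.1 hC₀ hd hd1 hG ⟨h, hx.2⟩ hgt
          (by rw [sub_self, abs_zero]; exact abs_nonneg _)).trans hCd
    · have hshift : |x + (xs - s) - x| ≤ |s - xs| := by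
        rw [add_sub_cancel_left, abs_sub_comm]
      rcases lt_or_gt_of_ne hx' with h | h
      · rw [hm ⟨hx.1, h⟩]
        exact (S.abs_deriv_left hxs.1 hC₀ hd hd1 hG ⟨hx.1, h.le⟩ (by linarith) hshift).trans hCd
      · rw [hp ⟨h, hx.2⟩]
        exact (S.abs_deriv_right hxs.1 hC₀ hd hd1 hG ⟨h.le, hx.2⟩ (by linarith) hshift).trans hCd
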